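/- **Corollary (quantum memory speedup).** For an integer $m\ge 2$ put $d=m^2$ and consider the bipartite system $\mathcal H_A\otimes\mathcal H_B$ with $\mathcal H_A=\mathcal H_B=\mathbb C^m$. Let $\pi^*_{d,1}$ be the following law of a random state $\rho$: with probability $\frac12$, $\rho=|\psi\rangle\langle\psi|$ for a Haar random pure state $|\psi\rangle=U|0\rangle\in\mathcal H_A\otimes\mathcal H_B$, and with probability $\frac12$, $\rho=|\psi_A\rangle\langle\psi_A|\otimes|\psi_B\rangle\langle\psi_B|$ for independent Haar random pure states $|\psi_A\rangle,|\psi_B\rangle\in\mathbb C^m$. A state is entangled ($\rho\in\mathrm{ENT}$) if it is not a finite convex combination of product states $\rho_A\otimes\rho_B$. An entanglement detection protocol receives copies of $\rho\sim\pi^*_{d,1}$, computes a real number $\hat C(\rho)$ from its measurement data, and declares "entangled" if $\hat C(\rho)<0$. Its completeness is $\Pr[\hat C(\rho)<0]$ and its soundness is $\Pr[\rho\in\mathrm{ENT}\mid\hat C(\rho)<0]$. A protocol with quantum memory on $T$ copies performs a joint (finite-outcome) POVM on $\rho^{\otimes T}$. An adaptive single-copy protocol with at most $T$ copies is a decision tree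 of depth at most $T$: in each step one fresh copy of $\rho$ is measured by a finite-outcome POVM that may depend on all earlier outcomes, and $\hat C$ is a function of the leaf that is reached. The SWAP-test protocol on $2N$ copies measures, on each of $N$ disjoint pairs of copies, the operator $S_A$ that swaps the two copies of subsystem $A$ (effects $(\mathbb 1\pm S_A)/2$), with outcomes $s_1,\dots,s_N\in\{\pm1\}$, and uses $\hat C=\frac1N\sum_{j}s_j-1$, an estimate of $\operatorname{Tr}(\rho_A^2)-\operatorname{Tr}(\rho^2)$ for pure $\rho$. Then quantum memory gives an exponential (in the number $\log_2 d$ of qubits) speedup in sample complexity: 1. ($O(1)$ copies suffice with memory.) There is a number $N$, independent of $m$, such that for every $m\ge2$ the SWAP-test protocol on $2N$ copies has completeness at least $\frac14$ and soundness at least $\frac56$; moreover some protocol with quantum memory on $2N$ copies has completeness exactly $\frac14$ and soundness exactly $\frac56$. 2. ($\Omega(d^{1/4})$ copies are necessary without memory.) There is a constant $c>0$, independent of $m$, such that for every $m\ge2$ and every $T$, each adaptive single-copy protocol that uses at most $T$ copies and has completeness at least $\frac14$ and soundness at least $\frac56$ (in particular, each one with completeness $\frac14$ and soundness $\frac56$)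 satisfies $T\ge c\,d^{1/4}$. -/

import Mathlib

open MeasureTheory Matrix
open scoped ComplexOrder Kronecker ENNReal

namespace EDP

/-! ### States, separability and entanglement -/

/-- Density matrices: positive semidefinite with unit trace. -/
def IsDensity {ι : Type} [Fintype ι] (ρ : Matrix ι ι ℂ) : Prop :=
  ρ.PosSemidef ∧ ρ.trace = 1

/-- A bipartite state is separable if it is a finite convex combination of products of states. -/
def IsSeparable {A B : Type} [Fintype A] [Fintype B] (ρ : Matrix (A × B) (A × B) ℂ) : Prop :=
  ∃ (k : ℕ) (p : Fin k → ℝ) (ρA : Fin k → Matrix A A ℂ) (ρB : Fin k → Matrix B B ℂ),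
    (∀ i, 0 ≤ p i) ∧ ∑ i, p i = 1 ∧ (∀ i, IsDensity (ρA i)) ∧ (∀ i, IsDensity (ρB i)) ∧
      ρ = ∑ i, (p i : ℂ) • (ρA i ⊗ₖ ρB i)

/-- The set ENT of entangled states: the states that are not separable. -/
def entangled (A B : Type) [Fintype A] [Fintype B] : Set (Matrix (A × B) (A × B) ℂ) :=
  {ρ | IsDensity ρ ∧ ¬ IsSeparable ρ}

/-! ### Haar random states -/

/-- Complex matrices carry the Borel sigma-algebra. -/
noncomputable instance instMeasurableSpaceMatrix {ι κ : Type} : MeasurableSpace (Matrix ι κ ℂ) := borel _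

instance instBorelSpaceMatrix {ι κ : Type} : BorelSpace (Matrix ι κ ℂ) := ⟨rfl⟩

theorem isCompact_unitaryGroup (ι : Type) [Fintype ι] [DecidableEq ι] :
    IsCompact (Matrix.unitaryGroup ι ℂ : Set (Matrix ι ι ℂ)) := by
  have hK : IsCompact (Set.univ.pi fun _ : ι => Set.univ.pi fun _ : ι =>
      Metric.closedBall (0 : ℂ) 1) :=
    isCompact_univ_pi fun _ => isCompact_univ_pi fun _ => isCompact_closedBall 0 1
  have hK' : IsCompact {M : Matrix ι ι ℂ | ∀ i j, M i j ∈ Metric.closedBall (0 : ℂ) 1} := by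
    have h : {M : ι → ι → ℂ | ∀ i j, M i j ∈ Metric.closedBall (0 : ℂ) 1} =
        Set.univ.pi fun _ : ι => Set.univ.pi fun _ : ι => Metric.closedBall (0 : ℂ) 1 := by
      ext M
      simp only [Set.mem_ofPred_eq, Set.mem_pi, Set.mem_univ, true_implies]
    exact h ▸ hK
  refine hK'.of_isClosed_subset ?_ ?_
  · exact isClosed_unitary
  · intro U hU i j
    simpa using entry_norm_bound_of_unitary hU i j

instance instCompactSpaceUnitaryGroup (ι : Type) [Fintype ι] [DecidableEq ι] :
    CompactSpace (Matrix.unitaryGroup ι ℂ) :=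
  isCompact_iff_compactSpace.mp (isCompact_unitaryGroup ι)

/-- The Haar probability measure on the unitary group. -/
noncomputable def haarUnitary (ι : Type) [Fintype ι] [DecidableEq ι] :
    Measure (Matrix.unitaryGroup ι ℂ) :=
  Measure.haarMeasure ⊤

/-- The density matrix `|ψ⟩⟨ψ|`. -/
noncomputable def ketbra {ι : Type} (ψ : ι → ℂ) : Matrix ι ι ℂ := vecMulVec ψ (star ψ)

/-- The law of `|ψ⟩⟨ψ|` for a Haar random pure state `ψ = U |0⟩`,
where `U` is Haar distributed and `|0⟩` is a fixed basis vector. -/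
noncomputable def haarState (ι : Type) [Fintype ι] [DecidableEq ι] [Nonempty ι] :
    Measure (Matrix ι ι ℂ) :=
  (haarUnitary ι).map fun U : Matrix.unitaryGroup ι ℂ =>
    ketbra ((U : Matrix ι ι ℂ) *ᵥ Pi.single (Classical.arbitrary ι) 1)

/-- The law of `ρA ⊗ ρB` for two independent Haar random pure states. -/
noncomputable def haarProductState (A B : Type) [Fintype A] [DecidableEq A] [Nonempty A]
    [Fintype B] [DecidableEq B] [Nonempty B] : Measure (Matrix (A × B) (A × B) ℂ) :=
  ((haarState A).prod (haarState B)).map fun x => x.1 ⊗ₖ x.2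

/-- The law of the unknown state, with local dimension `m` and total dimension `d = m ^ 2`:
with probability one half a Haar random pure state of the whole system, with probability one half
a product of two independent Haar random local pure states. -/
noncomputable def taskLaw (m : ℕ) [NeZero m] :
    Measure (Matrix (Fin m × Fin m) (Fin m × Fin m) ℂ) :=
  (2⁻¹ : ℝ≥0∞) • haarState (Fin m × Fin m) + (2⁻¹ : ℝ≥0∞) • haarProductState (Fin m) (Fin m)

/-! ### Measurements and protocols -/

/-- Measurements with outcome set `Ω` on the Hilbert space with basis `ι`. -/
structure POVM (ι Ω : Type) [Fintype ι] [DecidableEq ι] [Fintype Ω] where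
  effect : Ω → Matrix ι ι ℂ
  posSemidef : ∀ ω, (effect ω).PosSemidef
  sum_effect : ∑ ω, effect ω = 1

/-- Born rule. -/
noncomputable def POVM.prob {ι Ω : Type} [Fintype ι] [DecidableEq ι] [Fintype Ω]
    (M : POVM ι Ω) (ρ : Matrix ι ι ℂ) (ω : Ω) : ℝ :=
  (M.effect ω * ρ).trace.re

/-- The state `ρ^{⊗ T}` of `T` copies of `ρ`. -/
noncomputable def tensorPower {ι : Type} (ρ : Matrix ι ι ℂ) (T : ℕ) : Matrix (Fin T → ι) (Fin T → ι) ℂ :=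
  Matrix.of fun x y => ∏ t, ρ (x t) (y t)

/-- A protocol with quantum memory on `T` copies: a joint measurement of all `T` copies, and an
estimator (a real number computed from the data); "entangled" is declared when the estimator is
negative. -/
structure JointProtocol (ι : Type) [Fintype ι] [DecidableEq ι] (T : ℕ) where
  Outcome : Type
  [fintypeOutcome : Fintype Outcome]
  povm : POVM (Fin T → ι) Outcome
  estimator : Outcome → ℝ

attribute [instance] JointProtocol.fintypeOutcome

/-- The probability that the protocol declares "entangled" on copies of `ρ`. -/
noncomputable def JointProtocol.detectProb {ι : Type} [Fintype ι] [DecidableEq ι] {T : ℕ}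
    (P : JointProtocol ι T) (ρ : Matrix ι ι ℂ) : ℝ :=
  ∑ ω, if P.estimator ω < 0 then P.povm.prob (tensorPower ρ T) ω else 0

/-- Adaptive single-copy protocols that use at most `T` copies: decision trees in which each step
consumes one fresh copy by a measurement that may depend on all earlier outcomes; at a leaf the
value of the estimator is output. -/
inductive SingleCopyProtocol (ι : Type) [Fintype ι] [DecidableEq ι] : ℕ → Type 1
  | output {T : ℕ} (value : ℝ) : SingleCopyProtocol ι T
  | measure {T : ℕ} {Ω : Type} [Fintype Ω] (M : POVM ι Ω)
      (next : Ω → SingleCopyProtocol ι T) : SingleCopyProtocol ι (T + 1)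

/-- The probability that the protocol declares "entangled" (negative output) on copies of `ρ`. -/
noncomputable def SingleCopyProtocol.detectProb {ι : Type} [Fintype ι] [DecidableEq ι]
    {T : ℕ} : SingleCopyProtocol ι T → Matrix ι ι ℂ → ℝ
  | .output value, _ => if value < 0 then 1 else 0
  | @SingleCopyProtocol.measure _ _ _ _ Ω _ M next, ρ => ∑ ω : Ω, M.prob ρ ω * (next ω).detectProb ρ

/-- The probability of declaring "entangled", for a state drawn from `π` and a protocol that
declares "entangled" on `ρ` with probability `p ρ`. -/
noncomputable def completeness {A B : Type} (π : Measure (Matrix (A × B) (A × B) ℂ))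
    (p : Matrix (A × B) (A × B) ℂ → ℝ) : ℝ :=
  ∫ ρ, p ρ ∂π

/-- The conditional probability that the state is entangled given that "entangled" is declared. -/
noncomputable def soundness {A B : Type} [Fintype A] [Fintype B]
    (π : Measure (Matrix (A × B) (A × B) ℂ)) (p : Matrix (A × B) (A × B) ℂ → ℝ) : ℝ :=
  (∫ ρ in entangled A B, p ρ ∂π) / ∫ ρ, p ρ ∂π

/-! ### The SWAP test for the purity of the first subsystem -/

/-- The unitary on two copies of a bipartite system that swaps the two copies of `A`. -/
noncomputable def swapA (A B : Type) [DecidableEq A] [DecidableEq B] :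
    Matrix ((A × B) × (A × B)) ((A × B) × (A × B)) ℂ :=
  Matrix.of fun x y => if x = ((y.2.1, y.1.2), (y.1.1, y.2.2)) then 1 else 0

/-- The sign of an outcome of the SWAP test. -/
noncomputable def sign (b : Bool) : ℝ := if b then 1 else -1

/-- The two effects `(1 ± S_A) / 2` of the SWAP test. -/
noncomputable def swapEffect (A B : Type) [DecidableEq A] [DecidableEq B] (b : Bool) :
    Matrix ((A × B) × (A × B)) ((A × B) × (A × B)) ℂ :=
  (2⁻¹ : ℂ) • (1 + (sign b : ℂ) • swapA A B)

/-- The `j`-th pair of copies among `N` consecutive pairs. -/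
def pair {ι : Type} {N : ℕ} (j : Fin N) (x : Fin (N * 2) → ι) : ι × ι :=
  (x (finProdFinEquiv (j, 0)), x (finProdFinEquiv (j, 1)))

theorem pair_ext {ι : Type} {N : ℕ} {x y : Fin (N * 2) → ι} :
    (∀ j, pair j x = pair j y) ↔ x = y := by
  refine ⟨fun h => ?_, fun h j => by rw [h]⟩
  funext c
  obtain ⟨⟨j, b⟩, rfl⟩ := finProdFinEquiv.surjective c
  have hj := h j
  simp only [pair, Prod.mk.injEq] at hj
  fin_cases b
  · exact hj.1
  · exact hj.2

/-- Splitting the copies into pairs. -/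
def pairEquiv (ι : Type) (N : ℕ) : (Fin (N * 2) → ι) ≃ (Fin N → ι × ι) where
  toFun x j := pair j x
  invFun y c := if (finProdFinEquiv.symm c).2 = 0 then (y (finProdFinEquiv.symm c).1).1
    else (y (finProdFinEquiv.symm c).1).2
  left_inv x := by
    refine pair_ext.mp fun j => ?_
    simp [pair]
  right_inv y := by
    funext j
    simp [pair]

section

variable {A B : Type} [DecidableEq A] [DecidableEq B]

theorem swapA_mul_self [Fintype A] [Fintype B] : swapA A B * swapA A B = 1 := by
  ext x y
  simp only [swapA, Matrix.mul_apply, Matrix.of_apply, Matrix.one_apply]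
  rw [Finset.sum_eq_single ((y.2.1, y.1.2), (y.1.1, y.2.2))] <;> simp +contextual

theorem swapA_conjTranspose : (swapA A B)ᴴ = swapA A B := by
  ext ⟨⟨a, b⟩, ⟨c, d⟩⟩ ⟨⟨a', b'⟩, ⟨c', d'⟩⟩
  simp only [swapA, Matrix.conjTranspose_apply, Matrix.of_apply, Prod.mk.injEq, apply_ite star,
    star_one, star_zero]
  congr 1
  simp only [eq_iff_iff]
  constructor <;> rintro ⟨⟨rfl, rfl⟩, rfl, rfl⟩ <;> simp

theorem swapEffect_conjTranspose (b : Bool) : (swapEffect A B b)ᴴ = swapEffect A B b := by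
  simp [swapEffect, Matrix.conjTranspose_smul, swapA_conjTranspose]

theorem swapEffect_mul_self [Fintype A] [Fintype B] (b : Bool) :
    swapEffect A B b * swapEffect A B b = swapEffect A B b := by
  have h : (sign b : ℂ) * (sign b : ℂ) = 1 := by cases b <;> simp [sign]
  simp only [swapEffect, Matrix.smul_mul, Matrix.mul_smul, Matrix.add_mul, Matrix.mul_add,
    Matrix.one_mul, Matrix.mul_one, swapA_mul_self, smul_add, smul_smul, ← mul_assoc]
  have h4 : (2⁻¹ * sign b * 2⁻¹ * sign b : ℂ) = 4⁻¹ := by linear_combination (4⁻¹ : ℂ) * h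
  rw [h4]
  module

theorem sum_swapEffect : ∑ b, swapEffect A B b = 1 := by
  simp only [Fintype.sum_bool, swapEffect, sign]
  simp only [if_true, Bool.false_eq_true, if_false, Complex.ofReal_neg, Complex.ofReal_one]
  module

end

/-- The joint measurement of `N` pairs of copies by independent SWAP tests on the first subsystem;
the outcome records the `N` results. Its effects are the tensor products of the `N` effects. -/
noncomputable def swapTestPOVM (A B : Type) [Fintype A] [Fintype B] [DecidableEq A] [DecidableEq B]
    (N : ℕ) : POVM (Fin (N * 2) → A × B) (Fin N → Bool) where
  effect s := Matrix.of fun x y => ∏ j, swapEffect A B (s j) (pair j x) (pair j y)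
  posSemidef s := by
    set E : Matrix (Fin (N * 2) → A × B) (Fin (N * 2) → A × B) ℂ :=
      Matrix.of fun x y => ∏ j, swapEffect A B (s j) (pair j x) (pair j y) with hE
    have h : E = Eᴴ * E := by
      ext x y
      simp only [hE, Matrix.mul_apply, Matrix.conjTranspose_apply, Matrix.of_apply, star_prod,
        ← Finset.prod_mul_distrib]
      have e : ∀ F : Fin N → (A × B) × (A × B) → ℂ,
          ∑ z : Fin (N * 2) → A × B, ∏ j, F j (pair j z) = ∏ j, ∑ w, F j w := by
        intro F
        rw [Fintype.prod_sum]
        exact Fintype.sum_equiv (pairEquiv (A × B) N) _ _ fun _ => rfl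
      rw [e fun j w =>
        star (swapEffect A B (s j) w (pair j x)) * swapEffect A B (s j) w (pair j y)]
      refine Finset.prod_congr rfl fun j _ => ?_
      have hq : swapEffect A B (s j) =
          (swapEffect A B (s j))ᴴ * swapEffect A B (s j) := by
        rw [swapEffect_conjTranspose, swapEffect_mul_self]
      exact congrFun (congrFun hq (pair j x)) (pair j y)
    rw [h]
    exact Matrix.posSemidef_conjTranspose_mul_self E
  sum_effect := by
    ext x y
    simp only [Matrix.sum_apply, Matrix.of_apply]
    rw [← Fintype.prod_sum fun (j : Fin N) (b : Bool) => swapEffect A B b (pair j x) (pair j y)]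
    simp only [← Matrix.sum_apply, sum_swapEffect, Matrix.one_apply]
    rw [Finset.prod_ite_zero]
    simp [pair_ext]

/-- The SWAP-test protocol on `2 N` copies. The average of the `N` signs estimates `Tr (ρ_A ^ 2)`;
subtracting `1`, which is `Tr (ρ ^ 2)` for pure states, gives the estimator of the purity
criterion `Tr (ρ_A ^ 2) - Tr (ρ ^ 2)`. -/
noncomputable def swapTestProtocol (A B : Type) [Fintype A] [Fintype B] [DecidableEq A]
    [DecidableEq B] (N : ℕ) : JointProtocol (A × B) (N * 2) where
  Outcome := Fin N → Bool
  povm := swapTestPOVM A B N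
  estimator s := (∑ j, sign (s j)) / N - 1

end EDP

/-!
Integration by parts on the unit sphere makes multiplication by a linear form adjoint, up to a
scalar, to a directional derivative. Since differentiating a product of linear forms only adds
nonnegative terms, the mean of `∏ t, |⟨v t, ψ⟩| ^ 2` over a Haar vector `ψ` in dimension `d` is
at least `1 - T ^ 2 / (2 * d)` times the value at the maximally mixed state; conditioning on one
factor, product Haar states satisfy the same with `1 - T ^ 2 / m`. These one-sided bounds,
applied to the probabilities that a decision tree accepts and that it rejects, show that both
ensembles are accepted with probabilities differing little as long as `T ^ 2` is small against
`m`, whereas completeness `1/4` and soundness `5/6` force a constant gap.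

With memory, `N` swap tests all answer `+1` with probability `((1 + tr (ρ_A ^ 2)) / 2) ^ N`,
which is `1` on separable pure states, so a declaration of entanglement is never wrong. On Haar
states, convexity and the mean purity bound this probability. For `m = 2` the bound so obtained
never drops below `3/5`, while completeness `1/4` requires `1/2`, and the second moment of
`|det ψ| ^ 2` is used instead. Randomizing the protocol then lowers its completeness and
soundness to the exact values.
-/

namespace EDP

open MvPolynomial ComplexConjugate

section General

theorem integrable_of_continuous_of_ae_mem_isCompact {X E : Type*} [TopologicalSpace X] [T2Space X]
    [MeasurableSpace X] [OpensMeasurableSpace X] [NormedAddCommGroup E]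
    [SecondCountableTopologyEither X E] {μ : Measure X} [IsFiniteMeasureOnCompacts μ] {K : Set X}
    (hK : IsCompact K) (hμ : ∀ᵐ x ∂μ, x ∈ K) {f : X → E} (hf : Continuous f) :
    Integrable f μ := by
  rw [← Measure.restrict_eq_self_of_ae_mem hμ]
  exact hf.continuousOn.integrableOn_compact' hK hK.measurableSet

theorem integral_eq_zero_of_measurePreserving_flow {Ω E : Type*} [MeasurableSpace Ω]
    [NormedAddCommGroup E] [NormedSpace ℝ E] {μ : Measure Ω} [IsFiniteMeasure μ] {φ : ℝ → Ω → Ω}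
    (hφ : ∀ t, MeasurePreserving (φ t) μ μ) (hφ₀ : φ 0 = id) {h h' : Ω → E}
    (hh : Integrable h μ) (hh' : AEStronglyMeasurable h' μ) {K : ℝ}
    (hK : ∀ᵐ ω ∂μ, ∀ t, ‖h' (φ t ω)‖ ≤ K)
    (hd : ∀ ω t, HasDerivAt (fun t => h (φ t ω)) (h' (φ t ω)) t) :
    ∫ ω, h' ω ∂μ = 0 := by
  have hint : ∀ t, Integrable (fun ω => h (φ t ω)) μ := fun t =>
    (hφ t).integrable_comp_of_integrable hh
  have hconst : ∀ t, ∫ ω, h (φ t ω) ∂μ = ∫ ω, h ω ∂μ := fun t => by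
    conv_rhs => rw [← (hφ t).map_eq]
    refine (integral_map (hφ t).measurable.aemeasurable ?_).symm
    rw [(hφ t).map_eq]
    exact hh.aestronglyMeasurable
  have hderiv := (hasDerivAt_integral_of_dominated_loc_of_deriv_le (x₀ := (0 : ℝ)) (s := Set.univ)
    (F := fun t ω => h (φ t ω)) (F' := fun t ω => h' (φ t ω)) (bound := fun _ => K)
    Filter.univ_mem (.of_forall fun t => (hint t).aestronglyMeasurable) (hint 0)
    (hh'.comp_measurePreserving (hφ 0)) (hK.mono fun ω hω t _ => hω t) (integrable_const K)
    (ae_of_all _ fun ω t _ => hd ω t)).2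
  simp only [hconst, hφ₀, id_eq] at hderiv
  exact hderiv.unique (hasDerivAt_const 0 _)

theorem hasDerivAt_eval_derivation {σ : Type*}
    (D : Derivation ℂ (MvPolynomial σ ℂ) (MvPolynomial σ ℂ)) {c : ℝ → σ → ℂ} {t : ℝ}
    (hc : ∀ i, HasDerivAt (fun t => c t i) (eval (c t) (D (X i))) t) (f : MvPolynomial σ ℂ) :
    HasDerivAt (fun t => eval (c t) f) (eval (c t) (D f)) t := by
  induction f using MvPolynomial.induction_on with
  | C a => simpa using hasDerivAt_const t a
  | add p q hp hq =>
    simp only [map_add]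
    exact hp.add hq
  | mul_X p i hp =>
    simp only [map_mul, eval_X, Derivation.leibniz, map_add, smul_eq_mul]
    refine (hp.mul (hc i)).congr_deriv ?_
    ring

end General

section UnitVectors

variable (ι : Type) [Fintype ι]

/-- The unit vectors for the Hermitian norm; `Metric.sphere` would refer to the supremum norm that
functions carry. -/
def unitVectors : Set (ι → ℂ) := {x | star x ⬝ᵥ x = 1}

variable {ι}

theorem dotProduct_star_self_eq_sum_normSq (x : ι → ℂ) :
    star x ⬝ᵥ x = ((∑ i, Complex.normSq (x i) : ℝ) : ℂ) := by
  simp [dotProduct, Complex.normSq_eq_conj_mul_self]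

theorem mem_unitVectors {x : ι → ℂ} : x ∈ unitVectors ι ↔ ∑ i, Complex.normSq (x i) = 1 := by
  rw [unitVectors, Set.mem_ofPred_eq, dotProduct_star_self_eq_sum_normSq]
  norm_cast

theorem mulVec_mem_unitVectors [DecidableEq ι] {U : Matrix ι ι ℂ} (hU : U ∈ unitaryGroup ι ℂ)
    {x : ι → ℂ} (hx : x ∈ unitVectors ι) : U *ᵥ x ∈ unitVectors ι := by
  rw [unitVectors, Set.mem_ofPred_eq, star_mulVec, ← dotProduct_mulVec, mulVec_mulVec,
    ← star_eq_conjTranspose, mem_unitaryGroup_iff'.mp hU, one_mulVec]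
  exact hx

theorem single_mem_unitVectors [DecidableEq ι] (i : ι) : Pi.single i 1 ∈ unitVectors ι := by
  simp [unitVectors]

theorem isCompact_unitVectors : IsCompact (unitVectors ι) := by
  refine (isCompact_closedBall (0 : ι → ℂ) 1).of_isClosed_subset ?_ fun x hx => ?_
  · exact isClosed_eq (by unfold dotProduct; fun_prop) continuous_const
  · rw [mem_closedBall_zero_iff, pi_norm_le_iff_of_nonneg zero_le_one]
    intro i
    rw [mem_unitVectors] at hx
    have hi : Complex.normSq (x i) ≤ 1 := hx ▸ Finset.single_le_sum
      (fun j _ => Complex.normSq_nonneg (x j)) (Finset.mem_univ i)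
    rwa [Complex.normSq_eq_norm_sq, sq_le_one_iff₀ (norm_nonneg _)] at hi

end UnitVectors

section HaarVector

variable (ι : Type) [Fintype ι] [DecidableEq ι]

instance : IsProbabilityMeasure (haarUnitary ι) :=
  ⟨Measure.haarMeasure_self (K₀ := ⊤)⟩

instance : (haarUnitary ι).IsMulLeftInvariant := by
  unfold haarUnitary
  infer_instance

/-- The law of a Haar random unit vector. -/
noncomputable def haarVector [Nonempty ι] : Measure (ι → ℂ) :=
  (haarUnitary ι).map fun U : Matrix.unitaryGroup ι ℂ =>
    (U : Matrix ι ι ℂ) *ᵥ Pi.single (Classical.arbitrary ι) 1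

variable {ι}

theorem continuous_unitary_mulVec (x : ι → ℂ) :
    Continuous fun U : Matrix.unitaryGroup ι ℂ => (U : Matrix ι ι ℂ) *ᵥ x :=
  continuous_subtype_val.matrix_mulVec continuous_const

variable [Nonempty ι]

instance : IsProbabilityMeasure (haarVector ι) :=
  Measure.isProbabilityMeasure_map (continuous_unitary_mulVec _).measurable.aemeasurable

theorem ae_haarVector_mem_unitVectors : ∀ᵐ x ∂haarVector ι, x ∈ unitVectors ι :=
  (ae_map_iff (continuous_unitary_mulVec _).measurable.aemeasurable
    isCompact_unitVectors.measurableSet).mpr <|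
    ae_of_all _ fun U => mulVec_mem_unitVectors U.2 (single_mem_unitVectors _)

theorem measurePreserving_mulVec_haarVector {V : Matrix ι ι ℂ} (hV : V ∈ unitaryGroup ι ℂ) :
    MeasurePreserving (V *ᵥ ·) (haarVector ι) (haarVector ι) := by
  have hVm : Measurable (V *ᵥ · : (ι → ℂ) → ι → ℂ) :=
    (continuous_const.matrix_mulVec continuous_id).measurable
  refine ⟨hVm, ?_⟩
  have hmeas := (continuous_unitary_mulVec (Pi.single (Classical.arbitrary ι) 1 : ι → ℂ)).measurable
  conv_rhs => rw [haarVector, ← map_mul_left_eq_self (haarUnitary ι) ⟨V, hV⟩]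
  rw [haarVector, Measure.map_map hVm hmeas,
    Measure.map_map hmeas (continuous_const_mul _).measurable]
  congr 1
  funext U
  exact mulVec_mulVec _ _ _

theorem integrable_haarVector {E : Type*} [NormedAddCommGroup E] {f : (ι → ℂ) → E}
    (hf : Continuous f) : Integrable f (haarVector ι) :=
  integrable_of_continuous_of_ae_mem_isCompact isCompact_unitVectors ae_haarVector_mem_unitVectors
    hf

end HaarVector

section IntegrationByParts

theorem continuous_eval_mul_conj_eval {ι : Type} (f g : MvPolynomial ι ℂ) :
    Continuous fun x : ι → ℂ => eval x f * conj (eval x g) :=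
  (continuous_eval f).mul (Complex.continuous_conj.comp (continuous_eval g))

variable {ι : Type} [Fintype ι]

/-- The derivation of the polynomial ring that is the vector field `x ↦ M x`. -/
noncomputable def linearDeriv (M : Matrix ι ι ℂ) :
    Derivation ℂ (MvPolynomial ι ℂ) (MvPolynomial ι ℂ) :=
  mkDerivation ℂ fun i => ∑ j, M i j • X j

theorem linearDeriv_X (M : Matrix ι ι ℂ) (i : ι) : linearDeriv M (X i) = ∑ j, M i j • X j :=
  mkDerivation_X ℂ _ i

theorem eval_linearDeriv_X (M : Matrix ι ι ℂ) (i : ι) (x : ι → ℂ) :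
    eval x (linearDeriv M (X i)) = (M *ᵥ x) i := by
  simp [linearDeriv_X, mulVec, dotProduct]

theorem linearDeriv_add (M N : Matrix ι ι ℂ) :
    linearDeriv (M + N) = linearDeriv M + linearDeriv N :=
  derivation_ext fun i => by simp [linearDeriv_X, add_smul, Finset.sum_add_distrib]

theorem linearDeriv_smul (c : ℂ) (M : Matrix ι ι ℂ) : linearDeriv (c • M) = c • linearDeriv M :=
  derivation_ext fun i => by simp [linearDeriv_X, mul_smul, Finset.smul_sum]

theorem linearDeriv_single [DecidableEq ι] (i j : ι) (f : MvPolynomial ι ℂ) :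
    linearDeriv (Matrix.single i j 1) f = X j * pderiv i f := by
  have h : linearDeriv (Matrix.single i j 1) = (X j : MvPolynomial ι ℂ) • pderiv i :=
    derivation_ext fun k => by
      rw [linearDeriv_X, Finset.sum_eq_single j] <;>
        simp +contextual [Matrix.single_apply, pderiv_X, Pi.single_apply, eq_comm]
  rw [h, Derivation.smul_apply, smul_eq_mul]

variable [DecidableEq ι]

theorem exp_smul_mem_unitaryGroup {A : Matrix ι ι ℂ} (hA : A ∈ skewAdjoint (Matrix ι ι ℂ))
    (t : ℝ) : NormedSpace.exp (t • A) ∈ unitaryGroup ι ℂ := by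
  rw [mem_unitaryGroup_iff', star_eq_conjTranspose, ← exp_conjTranspose, ← star_eq_conjTranspose,
    skewAdjoint.mem_iff.mp (skewAdjoint.smul_mem t hA),
    ← exp_add_of_commute _ _ (Commute.refl (t • A)).neg_left, neg_add_cancel,
    NormedSpace.exp_zero]

open scoped Matrix.Norms.Operator in
theorem hasDerivAt_exp_smul_mulVec (A : Matrix ι ι ℂ) (x : ι → ℂ) (t : ℝ) :
    HasDerivAt (fun t : ℝ => NormedSpace.exp (t • A) *ᵥ x)
      (A *ᵥ (NormedSpace.exp (t • A) *ᵥ x)) t := by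
  have h := hasDerivAt_exp_smul_const' (𝕂 := ℝ) A t
  rw [mulVec_mulVec]
  exact ((mulVecBilin ℝ ℝ).flip x).toContinuousLinearMap.hasFDerivAt.comp_hasDerivAt t h

variable [Nonempty ι]

theorem integrable_eval_mul_conj_eval (f g : MvPolynomial ι ℂ) :
    Integrable (fun x => eval x f * conj (eval x g)) (haarVector ι) :=
  integrable_haarVector (continuous_eval_mul_conj_eval f g)

/-- The sesquilinear form `E[f(x) conj (g(x))]` on polynomials in a Haar random unit vector `x`. -/
noncomputable def polyInner : MvPolynomial ι ℂ →ₗ[ℂ] MvPolynomial ι ℂ →ₗ⋆[ℂ] ℂ :=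
  LinearMap.mk₂'ₛₗ (RingHom.id ℂ) (starRingEnd ℂ)
    (fun f g => ∫ x, eval x f * conj (eval x g) ∂haarVector ι)
    (fun f₁ f₂ g => by
      simpa only [map_add, add_mul] using integral_add (integrable_eval_mul_conj_eval f₁ g)
        (integrable_eval_mul_conj_eval f₂ g))
    (fun c f g => by
      simpa only [smul_eval, mul_assoc, smul_eq_mul, RingHom.id_apply] using integral_const_mul _ _)
    (fun f g₁ g₂ => by
      simpa only [map_add, mul_add] using integral_add (integrable_eval_mul_conj_eval f g₁)
        (integrable_eval_mul_conj_eval f g₂))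
    (fun c f g => by
      simpa only [smul_eval, map_mul, mul_left_comm, smul_eq_mul] using integral_const_mul _ _)

theorem polyInner_apply (f g : MvPolynomial ι ℂ) :
    polyInner f g = ∫ x, eval x f * conj (eval x g) ∂haarVector ι := rfl

theorem polyInner_self (f : MvPolynomial ι ℂ) :
    polyInner f f = ((∫ x, Complex.normSq (eval x f) ∂haarVector ι : ℝ) : ℂ) := by
  rw [polyInner_apply, ← integral_complex_ofReal]
  simp only [Complex.mul_conj]

theorem polyInner_self_nonneg (f : MvPolynomial ι ℂ) : 0 ≤ polyInner f f := by
  rw [polyInner_self]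
  exact_mod_cast integral_nonneg fun x => Complex.normSq_nonneg _

theorem polyInner_linearDeriv_of_mem_skewAdjoint {A : Matrix ι ι ℂ}
    (hA : A ∈ skewAdjoint (Matrix ι ι ℂ)) (f g : MvPolynomial ι ℂ) :
    polyInner (linearDeriv A f) g = -polyInner f (linearDeriv A g) := by
  set φ : ℝ → (ι → ℂ) → ι → ℂ := fun t x => NormedSpace.exp (t • A) *ᵥ x
  set h' : (ι → ℂ) → ℂ := fun x => eval x (linearDeriv A f) * conj (eval x g) +
    eval x f * conj (eval x (linearDeriv A g))
  have hunitary := exp_smul_mem_unitaryGroup hA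
  have hh' : Continuous h' := (continuous_eval_mul_conj_eval _ _).add
    (continuous_eval_mul_conj_eval _ _)
  have hderiv : ∀ p x t,
      HasDerivAt (fun t => eval (φ t x) p) (eval (φ t x) (linearDeriv A p)) t := fun p x t =>
    hasDerivAt_eval_derivation _ (fun i => eval_linearDeriv_X A i _ ▸
      hasDerivAt_pi.mp (hasDerivAt_exp_smul_mulVec A x t) i) p
  obtain ⟨K, hK⟩ := isCompact_unitVectors.exists_bound_of_continuousOn hh'.continuousOn
  have hzero : ∫ x, h' x ∂haarVector ι = 0 :=
    integral_eq_zero_of_measurePreserving_flow (φ := φ)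
      (fun t => measurePreserving_mulVec_haarVector (hunitary t)) (by funext x; simp [φ])
      (integrable_eval_mul_conj_eval f g) hh'.aestronglyMeasurable
      (ae_haarVector_mem_unitVectors.mono fun x hx t =>
        hK _ (mulVec_mem_unitVectors (hunitary t) hx))
      fun x t => (hderiv f x t).mul
        (Complex.conjCLE.toContinuousLinearMap.hasFDerivAt.comp_hasDerivAt t (hderiv g x t))
  rw [integral_add (integrable_eval_mul_conj_eval _ _) (integrable_eval_mul_conj_eval _ _)]
    at hzero
  exact eq_neg_of_add_eq_zero_left hzero

theorem polyInner_linearDeriv (M : Matrix ι ι ℂ) (f g : MvPolynomial ι ℂ) :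
    polyInner (linearDeriv M f) g = polyInner f (linearDeriv Mᴴ g) := by
  set A := M - Mᴴ with hA
  set B := Complex.I • (M + Mᴴ) with hB
  have hAf := polyInner_linearDeriv_of_mem_skewAdjoint (A := A)
    (by simp [skewAdjoint.mem_iff, hA, star_eq_conjTranspose]) f g
  have hBf := polyInner_linearDeriv_of_mem_skewAdjoint (A := B)
    (by simp [skewAdjoint.mem_iff, hB, star_eq_conjTranspose, add_comm]) f g
  have hM : M = (2⁻¹ : ℂ) • A + (-Complex.I / 2) • B := by
    rw [hA, hB, smul_smul, show -Complex.I / 2 * Complex.I = 2⁻¹ by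
      linear_combination (-1 / 2 : ℂ) * Complex.I_mul_I]
    module
  have hMH : Mᴴ = (-2⁻¹ : ℂ) • A + (-Complex.I / 2) • B := by
    rw [hA, hB, smul_smul, show -Complex.I / 2 * Complex.I = 2⁻¹ by
      linear_combination (-1 / 2 : ℂ) * Complex.I_mul_I]
    module
  rw [hMH]
  nth_rewrite 1 [hM]
  simp only [linearDeriv_add, linearDeriv_smul, Derivation.add_apply, Derivation.smul_apply,
    map_add, LinearMap.add_apply, map_smul, LinearMap.smul_apply, hAf, hBf, smul_eq_mul,
    LinearMap.map_smulₛₗ, map_neg, map_inv₀, map_div₀, Complex.conj_I, map_ofNat]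
  ring

end IntegrationByParts

section Moments

variable {ι : Type} [Fintype ι]

/-- The linear form `x ↦ ⟨v, x⟩`. -/
noncomputable def linearForm (v : ι → ℂ) : MvPolynomial ι ℂ := ∑ i, conj (v i) • X i

/-- The derivative in the direction `v`. -/
noncomputable def dirDeriv (v : ι → ℂ) : Derivation ℂ (MvPolynomial ι ℂ) (MvPolynomial ι ℂ) :=
  ∑ i, v i • pderiv i

theorem eval_linearForm (v x : ι → ℂ) : eval x (linearForm v) = star v ⬝ᵥ x := by
  simp [linearForm, dotProduct]

theorem isHomogeneous_linearForm (v : ι → ℂ) : (linearForm v).IsHomogeneous 1 :=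
  IsHomogeneous.sum _ _ _ fun i _ => by
    simpa only [smul_eq_C_mul] using (isHomogeneous_X ℂ i).C_mul _

theorem dirDeriv_apply (v : ι → ℂ) (f : MvPolynomial ι ℂ) :
    dirDeriv v f = ∑ i, v i • pderiv i f := by
  have hsum := map_sum Derivation.coeFnAddMonoidHom (fun i => v i • pderiv (R := ℂ) i) Finset.univ
  exact (congrFun hsum f).trans (by simp)

theorem isHomogeneous_dirDeriv {f : MvPolynomial ι ℂ} {k : ℕ} (hf : f.IsHomogeneous k)
    (v : ι → ℂ) : (dirDeriv v f).IsHomogeneous (k - 1) := by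
  rw [dirDeriv_apply]
  exact IsHomogeneous.sum _ _ _ fun i _ => by
    simpa only [smul_eq_C_mul] using hf.pderiv.C_mul _

theorem dirDeriv_linearForm (v : ι → ℂ) :
    dirDeriv v (linearForm v) = C ((∑ i, Complex.normSq (v i) : ℝ) : ℂ) := by
  classical
  simp [dirDeriv_apply, linearForm, pderiv_X, Pi.single_apply, smul_eq_C_mul,
    Complex.normSq_eq_conj_mul_self, mul_comm]

variable [DecidableEq ι] [Nonempty ι]

theorem conj_polyInner (f g : MvPolynomial ι ℂ) : conj (polyInner f g) = polyInner g f := by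
  rw [polyInner_apply, polyInner_apply, ← integral_conj]
  simp [mul_comm]

theorem polyInner_X_mul_pderiv (i j : ι) (f g : MvPolynomial ι ℂ) :
    polyInner (X i * pderiv j f) g = polyInner f (X j * pderiv i g) := by
  rw [← linearDeriv_single, ← linearDeriv_single, polyInner_linearDeriv, conjTranspose_single,
    star_one]

theorem sum_polyInner_X_mul_X_mul (f g : MvPolynomial ι ℂ) :
    ∑ i, polyInner (X i * f) (X i * g) = polyInner f g := by
  simp only [polyInner_apply]
  rw [← integral_finsetSum _ fun i _ => integrable_eval_mul_conj_eval _ _]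
  refine integral_congr_ae (ae_haarVector_mem_unitVectors.mono fun x hx => ?_)
  have hx' : ∑ i, x i * conj (x i) = 1 := by
    simpa [unitVectors, dotProduct, mul_comm] using hx
  calc ∑ i, eval x (X i * f) * conj (eval x (X i * g))
      = (∑ i, x i * conj (x i)) * (eval x f * conj (eval x g)) := by
        rw [Finset.sum_mul]
        refine Finset.sum_congr rfl fun i _ => ?_
        simp only [map_mul, eval_X]
        ring
    _ = eval x f * conj (eval x g) := by rw [hx', one_mul]

theorem polyInner_X_mul {f : MvPolynomial ι ℂ} {k : ℕ} (hf : f.IsHomogeneous k) (i : ι)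
    (g : MvPolynomial ι ℂ) :
    ((Fintype.card ι + k : ℕ) : ℂ) * polyInner (X i * f) g = polyInner f (pderiv i g) := by
  have hEuler : ∑ j, X i * pderiv j (X j * f) =
      ((Fintype.card ι + k : ℕ) : ℂ) • (X i * f) := by
    simp only [Derivation.leibniz, pderiv_X_self, smul_eq_mul, mul_one, ← Finset.mul_sum,
      Finset.sum_add_distrib, hf.sum_X_mul_pderiv, Finset.sum_const, Finset.card_univ]
    simp only [← Nat.cast_smul_eq_nsmul ℂ, ← add_smul, mul_smul_comm, Nat.cast_add, add_comm]
  calc ((Fintype.card ι + k : ℕ) : ℂ) * polyInner (X i * f) g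
      = ∑ j, polyInner (X i * pderiv j (X j * f)) g := by
        rw [← LinearMap.sum_apply, ← map_sum, hEuler, map_smul, LinearMap.smul_apply, smul_eq_mul]
    _ = ∑ j, polyInner (X j * f) (X j * pderiv i g) := by simp only [polyInner_X_mul_pderiv]
    _ = polyInner f (pderiv i g) := sum_polyInner_X_mul_X_mul f _

theorem polyInner_linearForm_mul {f : MvPolynomial ι ℂ} {k : ℕ} (hf : f.IsHomogeneous k)
    (v : ι → ℂ) (g : MvPolynomial ι ℂ) :
    ((Fintype.card ι + k : ℕ) : ℂ) * polyInner (linearForm v * f) g =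
      polyInner f (dirDeriv v g) := by
  simp only [linearForm, dirDeriv_apply, Finset.sum_mul, smul_mul_assoc, map_sum,
    LinearMap.sum_apply, map_smul, LinearMap.smul_apply, LinearMap.map_smulₛₗ, Finset.mul_sum,
    ← polyInner_X_mul hf, smul_eq_mul]
  exact Finset.sum_congr rfl fun i _ => by ring

theorem polyInner_linearForm_mul_dirDeriv_nonneg {f : MvPolynomial ι ℂ} {k : ℕ}
    (hf : f.IsHomogeneous k) (v : ι → ℂ) :
    0 ≤ polyInner (linearForm v * dirDeriv v f) f := by
  have hne : ((Fintype.card ι + (k - 1) : ℕ) : ℂ) ≠ 0 := by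
    exact_mod_cast (Nat.add_pos_left Fintype.card_pos _).ne'
  rw [← inv_mul_cancel_left₀ hne (polyInner _ _),
    polyInner_linearForm_mul (isHomogeneous_dirDeriv hf v)]
  refine mul_nonneg ?_ (polyInner_self_nonneg _)
  rw [← Complex.ofReal_natCast, ← Complex.ofReal_inv, Complex.zero_le_real]
  positivity

theorem sum_normSq_mul_polyInner_self_le {f : MvPolynomial ι ℂ} {k : ℕ} (hf : f.IsHomogeneous k)
    (v : ι → ℂ) :
    ((∑ i, Complex.normSq (v i) : ℝ) : ℂ) * polyInner f f ≤
      ((Fintype.card ι + k : ℕ) : ℂ) * polyInner (linearForm v * f) (linearForm v * f) := by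
  have hcross : 0 ≤ polyInner f (linearForm v * dirDeriv v f) := by
    rw [← conj_polyInner]
    exact star_nonneg_iff.mpr (polyInner_linearForm_mul_dirDeriv_nonneg hf v)
  rw [polyInner_linearForm_mul hf, Derivation.leibniz, dirDeriv_linearForm, map_add, smul_eq_mul,
    smul_eq_mul, mul_comm f, ← smul_eq_C_mul, LinearMap.map_smulₛₗ, Complex.conj_ofReal]
  exact le_add_of_nonneg_left hcross

theorem prod_sum_normSq_le_ascFactorial_mul_integral {κ : Type*} (s : Finset κ) (v : κ → ι → ℂ) :
    ∏ t ∈ s, ∑ i, Complex.normSq (v t i) ≤ (Fintype.card ι).ascFactorial s.card *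
      ∫ x, ∏ t ∈ s, Complex.normSq (star (v t) ⬝ᵥ x) ∂haarVector ι := by
  classical
  induction s using Finset.induction_on with
  | empty => simp
  | insert t s ht ih =>
    set f : MvPolynomial ι ℂ := ∏ u ∈ s, linearForm (v u) with hf
    have hhom : f.IsHomogeneous s.card := by
      simpa using IsHomogeneous.prod s _ _ fun u _ => isHomogeneous_linearForm (v u)
    have heval : ∀ x, Complex.normSq (eval x f) = ∏ u ∈ s, Complex.normSq (star (v u) ⬝ᵥ x) := by
      simp [hf, map_prod, eval_linearForm]
    have hstep := sum_normSq_mul_polyInner_self_le hhom (v t)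
    simp only [polyInner_self, map_mul, heval, eval_linearForm] at hstep
    norm_cast at hstep
    simp only [Finset.prod_insert ht, Finset.card_insert_of_notMem ht, Nat.ascFactorial_succ,
      Nat.cast_mul]
    calc (∑ i, Complex.normSq (v t i)) * ∏ u ∈ s, ∑ i, Complex.normSq (v u i)
        ≤ (∑ i, Complex.normSq (v t i)) * ((Fintype.card ι).ascFactorial s.card *
          ∫ x, ∏ u ∈ s, Complex.normSq (star (v u) ⬝ᵥ x) ∂haarVector ι) :=
          mul_le_mul_of_nonneg_left ih (Finset.sum_nonneg fun i _ => Complex.normSq_nonneg _)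
      _ = (Fintype.card ι).ascFactorial s.card * ((∑ i, Complex.normSq (v t i)) *
          ∫ x, ∏ u ∈ s, Complex.normSq (star (v u) ⬝ᵥ x) ∂haarVector ι) := mul_left_comm _ _ _
      _ ≤ (Fintype.card ι).ascFactorial s.card * (((Fintype.card ι + s.card : ℕ) : ℝ) *
          ∫ x, Complex.normSq (star (v t) ⬝ᵥ x) *
            ∏ u ∈ s, Complex.normSq (star (v u) ⬝ᵥ x) ∂haarVector ι) := by gcongr
      _ = _ := by ring

end Moments

section PureStates

variable {ι A B : Type} [Fintype ι] [Fintype A] [Fintype B]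

variable (ι) in
/-- The pure states `|ψ⟩⟨ψ|` with a unit vector `ψ`. -/
def pureStates : Set (Matrix ι ι ℂ) := ketbra '' unitVectors ι

theorem continuous_ketbra {ι : Type} : Continuous (ketbra : (ι → ℂ) → Matrix ι ι ℂ) :=
  continuous_id.matrix_vecMulVec continuous_star

theorem isCompact_pureStates : IsCompact (pureStates ι) :=
  isCompact_unitVectors.image continuous_ketbra

theorem isDensity_of_mem_pureStates {ρ : Matrix ι ι ℂ} (hρ : ρ ∈ pureStates ι) :
    IsDensity ρ := by
  obtain ⟨ψ, hψ, rfl⟩ := hρ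
  refine ⟨posSemidef_vecMulVec_self_star ψ, ?_⟩
  rw [ketbra, trace_vecMulVec, dotProduct_comm]
  exact hψ

theorem ketbra_kronecker_ketbra {A B : Type} (x : A → ℂ) (y : B → ℂ) :
    ketbra x ⊗ₖ ketbra y = ketbra fun p : A × B => x p.1 * y p.2 := by
  ext p q
  simp only [ketbra, kroneckerMap_apply, vecMulVec_apply, Pi.star_apply, star_mul']
  ring

theorem kronecker_mem_pureStates {ρ : Matrix A A ℂ} {τ : Matrix B B ℂ} (hρ : ρ ∈ pureStates A)
    (hτ : τ ∈ pureStates B) : ρ ⊗ₖ τ ∈ pureStates (A × B) := by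
  obtain ⟨x, hx, rfl⟩ := hρ
  obtain ⟨y, hy, rfl⟩ := hτ
  refine ⟨_, ?_, (ketbra_kronecker_ketbra x y).symm⟩
  rw [mem_unitVectors] at hx hy ⊢
  simp only [Complex.normSq_mul, Fintype.sum_prod_type, ← Finset.mul_sum, hy, mul_one, hx]

theorem isSeparable_kronecker {ρ : Matrix A A ℂ} {τ : Matrix B B ℂ} (hρ : IsDensity ρ)
    (hτ : IsDensity τ) : IsSeparable (ρ ⊗ₖ τ) :=
  ⟨1, fun _ => 1, fun _ => ρ, fun _ => τ, fun _ => zero_le_one, by simp, fun _ => hρ, fun _ => hτ,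
    by simp⟩

theorem integrable_of_ae_mem_pureStates {π : Measure (Matrix ι ι ℂ)} [IsFiniteMeasure π]
    (hπ : ∀ᵐ ρ ∂π, ρ ∈ pureStates ι) {p : Matrix ι ι ℂ → ℝ} (hp : Continuous p) :
    Integrable p π :=
  integrable_of_continuous_of_ae_mem_isCompact isCompact_pureStates hπ hp

end PureStates

section HaarStates

variable {ι A B : Type} [Fintype ι] [DecidableEq ι] [Nonempty ι] [Fintype A] [DecidableEq A]
  [Nonempty A] [Fintype B] [DecidableEq B] [Nonempty B]

theorem haarState_eq_map : haarState ι = (haarVector ι).map ketbra :=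
  (Measure.map_map continuous_ketbra.measurable
    (continuous_unitary_mulVec (Pi.single (Classical.arbitrary ι) 1)).measurable).symm

instance : IsProbabilityMeasure (haarState ι) := by
  rw [haarState_eq_map]
  exact Measure.isProbabilityMeasure_map continuous_ketbra.measurable.aemeasurable

theorem ae_haarState_mem_pureStates : ∀ᵐ ρ ∂haarState ι, ρ ∈ pureStates ι := by
  rw [haarState_eq_map]
  refine (ae_map_iff continuous_ketbra.measurable.aemeasurable
    isCompact_pureStates.measurableSet).mpr ?_
  exact ae_haarVector_mem_unitVectors.mono fun x hx => ⟨x, hx, rfl⟩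

theorem integral_haarState {p : Matrix ι ι ℂ → ℝ} (hp : Continuous p) :
    ∫ ρ, p ρ ∂haarState ι = ∫ x, p (ketbra x) ∂haarVector ι := by
  rw [haarState_eq_map, integral_map continuous_ketbra.measurable.aemeasurable
    hp.aestronglyMeasurable]

instance {ι κ : Type} [Countable ι] [Countable κ] : SecondCountableTopology (Matrix ι κ ℂ) :=
  inferInstanceAs (SecondCountableTopology (ι → κ → ℂ))

theorem continuous_kronecker {A B : Type} :
    Continuous fun x : Matrix A A ℂ × Matrix B B ℂ => x.1 ⊗ₖ x.2 :=
  continuous_pi fun p => continuous_pi fun q =>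
    ((continuous_fst.matrix_elem p.1 q.1).mul (continuous_snd.matrix_elem p.2 q.2))

instance : IsProbabilityMeasure (haarProductState A B) :=
  Measure.isProbabilityMeasure_map continuous_kronecker.measurable.aemeasurable

theorem ae_haarProductState : ∀ᵐ ρ ∂haarProductState A B,
    ρ ∈ (fun x => x.1 ⊗ₖ x.2) '' (pureStates A ×ˢ pureStates B) := by
  have hK : IsCompact ((fun x : Matrix A A ℂ × Matrix B B ℂ => x.1 ⊗ₖ x.2) ''
    (pureStates A ×ˢ pureStates B)) :=
      (isCompact_pureStates.prod isCompact_pureStates).image continuous_kronecker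
  refine (ae_map_iff continuous_kronecker.measurable.aemeasurable hK.measurableSet).mpr ?_
  filter_upwards [Measure.quasiMeasurePreserving_fst.ae ae_haarState_mem_pureStates,
    Measure.quasiMeasurePreserving_snd.ae ae_haarState_mem_pureStates] with x hρ hτ
  exact ⟨x, ⟨hρ, hτ⟩, rfl⟩

theorem ae_haarProductState_mem_pureStates :
    ∀ᵐ ρ ∂haarProductState A B, ρ ∈ pureStates (A × B) := by
  filter_upwards [ae_haarProductState] with ρ hρ
  obtain ⟨x, hx, rfl⟩ := hρ
  exact kronecker_mem_pureStates hx.1 hx.2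

theorem ae_haarProductState_notMem_entangled :
    ∀ᵐ ρ ∂haarProductState A B, ρ ∉ entangled A B := by
  filter_upwards [ae_haarProductState] with ρ hρ hent
  obtain ⟨x, hx, rfl⟩ := hρ
  exact hent.2 (isSeparable_kronecker (isDensity_of_mem_pureStates hx.1)
    (isDensity_of_mem_pureStates hx.2))

theorem integrable_haarVector_prod {f : (A → ℂ) × (B → ℂ) → ℝ} (hf : Continuous f) :
    Integrable f ((haarVector A).prod (haarVector B)) := by
  refine integrable_of_continuous_of_ae_mem_isCompact
    (isCompact_unitVectors.prod isCompact_unitVectors) ?_ hf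
  filter_upwards [Measure.quasiMeasurePreserving_fst.ae ae_haarVector_mem_unitVectors,
    Measure.quasiMeasurePreserving_snd.ae ae_haarVector_mem_unitVectors] with x hx hy
  exact ⟨hx, hy⟩

theorem integral_haarProductState {p : Matrix (A × B) (A × B) ℂ → ℝ} (hp : Continuous p) :
    ∫ ρ, p ρ ∂haarProductState A B =
      ∫ x, ∫ y, p (ketbra fun ab : A × B => x ab.1 * y ab.2) ∂haarVector B ∂haarVector A := by
  have hcont : Continuous fun x : Matrix A A ℂ × Matrix B B ℂ => p (x.1 ⊗ₖ x.2) :=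
    hp.comp continuous_kronecker
  rw [haarProductState, integral_map continuous_kronecker.measurable.aemeasurable
    hp.aestronglyMeasurable, haarState_eq_map, haarState_eq_map,
    Measure.map_prod_map _ _ continuous_ketbra.measurable continuous_ketbra.measurable,
    integral_map (continuous_ketbra.prodMap continuous_ketbra).measurable.aemeasurable
      hcont.aestronglyMeasurable]
  refine (integral_prod _ (integrable_haarVector_prod
    (hcont.comp (continuous_ketbra.prodMap continuous_ketbra)))).trans ?_
  simp only [Function.comp_apply, Prod.map_apply, ketbra_kronecker_ketbra]

end HaarStates

section TaskLaw

variable {m : ℕ} [NeZero m]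

instance : IsProbabilityMeasure (taskLaw m) :=
  ⟨by simp [taskLaw, ENNReal.inv_two_add_inv_two]⟩

theorem ae_taskLaw_mem_pureStates :
    ∀ᵐ ρ ∂taskLaw m, ρ ∈ pureStates (Fin m × Fin m) := by
  rw [taskLaw, ae_add_measure_iff]
  exact ⟨Measure.ae_smul_measure ae_haarState_mem_pureStates _,
    Measure.ae_smul_measure ae_haarProductState_mem_pureStates _⟩

variable {p : Matrix (Fin m × Fin m) (Fin m × Fin m) ℂ → ℝ}

theorem completeness_taskLaw (hp : Continuous p) : completeness (taskLaw m) p =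
    (∫ ρ, p ρ ∂haarState (Fin m × Fin m) + ∫ ρ, p ρ ∂haarProductState (Fin m) (Fin m)) / 2 := by
  rw [completeness, taskLaw, integral_add_measure
    ((integrable_of_ae_mem_pureStates ae_haarState_mem_pureStates hp).smul_measure (by simp))
    ((integrable_of_ae_mem_pureStates ae_haarProductState_mem_pureStates hp).smul_measure
      (by simp)), integral_smul_measure, integral_smul_measure]
  simp only [ENNReal.toReal_inv, ENNReal.toReal_ofNat, smul_eq_mul]
  ring

theorem setIntegral_entangled_taskLaw_le (hp : Continuous p)
    (hp₀ : ∀ ρ ∈ pureStates (Fin m × Fin m), 0 ≤ p ρ) :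
    ∫ ρ in entangled (Fin m) (Fin m), p ρ ∂taskLaw m ≤
      (∫ ρ, p ρ ∂haarState (Fin m × Fin m)) / 2 := by
  have hrestrict : (haarProductState (Fin m) (Fin m)).restrict (entangled (Fin m) (Fin m)) = 0 :=
    Measure.restrict_eq_zero.mpr (measure_eq_zero_iff_ae_notMem.mpr
      ae_haarProductState_notMem_entangled)
  rw [taskLaw, Measure.restrict_add, Measure.restrict_smul, Measure.restrict_smul, hrestrict,
    smul_zero, add_zero, integral_smul_measure]
  have hle := setIntegral_le_integral (s := entangled (Fin m) (Fin m))
    (integrable_of_ae_mem_pureStates ae_haarState_mem_pureStates hp)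
    (ae_haarState_mem_pureStates.mono hp₀)
  simp only [ENNReal.toReal_inv, ENNReal.toReal_ofNat, smul_eq_mul]
  linarith

theorem taskLaw_real_entangled_le : (taskLaw m).real (entangled (Fin m) (Fin m)) ≤ 1 / 2 := by
  simpa using setIntegral_entangled_taskLaw_le (m := m) (p := 1) continuous_const
    fun _ _ => zero_le_one

end TaskLaw

section Protocols

theorem trace_mul_nonneg {ι : Type} [Fintype ι] {E ρ : Matrix ι ι ℂ} (hE : E.PosSemidef)
    (hρ : ρ.PosSemidef) : 0 ≤ (E * ρ).trace := by
  obtain ⟨n, v, rfl⟩ := posSemidef_iff_eq_sum_vecMulVec.mp hE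
  simp only [Finset.sum_mul, trace_sum, vecMulVec_mul, trace_vecMulVec]
  refine Finset.sum_nonneg fun i _ => ?_
  rw [dotProduct_comm, ← dotProduct_mulVec]
  exact hρ.dotProduct_mulVec_nonneg (v i)

variable {ι : Type} [Fintype ι] [DecidableEq ι] {ρ : Matrix ι ι ℂ}

theorem POVM.prob_nonneg {Ω : Type} [Fintype Ω] (M : POVM ι Ω) (hρ : IsDensity ρ) (ω : Ω) :
    0 ≤ M.prob ρ ω :=
  (Complex.le_def.mp (trace_mul_nonneg (M.posSemidef ω) hρ.1)).1

theorem POVM.sum_prob {Ω : Type} [Fintype Ω] (M : POVM ι Ω) (hρ : ρ.trace = 1) :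
    ∑ ω, M.prob ρ ω = 1 := by
  simp only [prob]
  rw [← Complex.re_sum, ← trace_sum, ← Finset.sum_mul, M.sum_effect, Matrix.one_mul, hρ,
    Complex.one_re]

theorem POVM.continuous_prob {Ω : Type} [Fintype Ω] (M : POVM ι Ω) (ω : Ω) :
    Continuous fun ρ => M.prob ρ ω :=
  Complex.continuous_re.comp (continuous_const.matrix_mul continuous_id).matrix_trace

namespace SingleCopyProtocol

variable {T : ℕ}

/-- The protocol that declares "entangled" exactly when the given one does not. -/
noncomputable def compl : {T : ℕ} → SingleCopyProtocol ι T → SingleCopyProtocol ι T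
  | _, .output value => .output (if value < 0 then 0 else -1)
  | _, @SingleCopyProtocol.measure _ _ _ _ _ _ M next => .measure M fun ω => (next ω).compl

theorem detectProb_compl (hρ : ρ.trace = 1) (P : SingleCopyProtocol ι T) :
    P.compl.detectProb ρ = 1 - P.detectProb ρ := by
  induction P with
  | output value => by_cases hvalue : value < 0 <;> simp [compl, detectProb, hvalue]
  | measure M next ih =>
    simp only [compl, detectProb, ih, mul_sub, mul_one, Finset.sum_sub_distrib, M.sum_prob hρ]

theorem detectProb_nonneg (hρ : IsDensity ρ) (P : SingleCopyProtocol ι T) :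
    0 ≤ P.detectProb ρ := by
  induction P with
  | output value =>
    simp only [detectProb]
    split_ifs <;> simp
  | measure M next ih =>
    exact Finset.sum_nonneg fun ω _ => mul_nonneg (M.prob_nonneg hρ ω) (ih ω)

theorem detectProb_le_one (hρ : IsDensity ρ) (P : SingleCopyProtocol ι T) :
    P.detectProb ρ ≤ 1 := by
  linarith [P.compl.detectProb_nonneg hρ, P.detectProb_compl hρ.2]

theorem continuous_detectProb (P : SingleCopyProtocol ι T) : Continuous P.detectProb := by
  induction P with
  | output value => exact continuous_const
  | measure M next ih =>
    exact continuous_finsetSum _ fun ω _ => (M.continuous_prob ω).mul (ih ω)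

end SingleCopyProtocol

end Protocols

section MomentDomination

variable {ι : Type} [Fintype ι]

/-- Every product of at most `T` rank-one expectations has mean under `π` at least `c` times its
value at `σ`. Since all effects are sums of rank-one ones, this controls every decision tree of
depth at most `T`. -/
def DominatesMoments (π : Measure (Matrix ι ι ℂ)) (σ : Matrix ι ι ℂ) (T : ℕ) (c : ℝ) : Prop :=
  ∀ k ≤ T, ∀ v : Fin k → ι → ℂ, c * ∏ t, (ketbra (v t) * σ).trace.re ≤
    ∫ ρ, ∏ t, (ketbra (v t) * ρ).trace.re ∂π

theorem continuous_prod_trace_ketbra_mul {k : ℕ} (v : Fin k → ι → ℂ) :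
    Continuous fun ρ : Matrix ι ι ℂ => ∏ t, (ketbra (v t) * ρ).trace.re :=
  continuous_finsetProd _ fun _ _ =>
    Complex.continuous_re.comp (continuous_const.matrix_mul continuous_id).matrix_trace

variable [DecidableEq ι]

theorem detectProb_measure_mul_prod {T k : ℕ} {Ω : Type} [Fintype Ω] (M : POVM ι Ω)
    (next : Ω → SingleCopyProtocol ι T) {n : Ω → ℕ} {w : ∀ ω, Fin (n ω) → ι → ℂ}
    (hw : ∀ ω, M.effect ω = ∑ r, ketbra (w ω r)) (v : Fin k → ι → ℂ) (ρ : Matrix ι ι ℂ) :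
    (SingleCopyProtocol.measure M next).detectProb ρ * ∏ t, (ketbra (v t) * ρ).trace.re =
      ∑ ω, ∑ r, (next ω).detectProb ρ *
        ∏ t, (ketbra ((Fin.cons (w ω r) v : Fin (k + 1) → ι → ℂ) t) * ρ).trace.re := by
  simp only [SingleCopyProtocol.detectProb, POVM.prob, hw, Fin.prod_univ_succ, Fin.cons_zero,
    Fin.cons_succ, Finset.sum_mul, trace_sum, Complex.re_sum]
  exact Finset.sum_congr rfl fun ω _ => Finset.sum_congr rfl fun r _ => by ring

variable {π : Measure (Matrix ι ι ℂ)} [IsFiniteMeasure π] {σ : Matrix ι ι ℂ} {c : ℝ}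

theorem DominatesMoments.detectProb_mul_prod_le {T₀ : ℕ} (hdom : DominatesMoments π σ T₀ c)
    (hπ : ∀ᵐ ρ ∂π, ρ ∈ pureStates ι) {T : ℕ} (P : SingleCopyProtocol ι T) {k : ℕ}
    (hk : k + T ≤ T₀) (v : Fin k → ι → ℂ) :
    c * (P.detectProb σ * ∏ t, (ketbra (v t) * σ).trace.re) ≤
      ∫ ρ, P.detectProb ρ * ∏ t, (ketbra (v t) * ρ).trace.re ∂π := by
  induction P generalizing k with
  | output value =>
    by_cases hvalue : value < 0
    · simpa [SingleCopyProtocol.detectProb, hvalue] using hdom k (by lia) v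
    · simp [SingleCopyProtocol.detectProb, hvalue]
  | measure M next ih =>
    choose n w hw using fun ω => posSemidef_iff_eq_sum_vecMulVec.mp (M.posSemidef ω)
    have hint (ω) (r : Fin (n ω)) : Integrable (fun ρ => (next ω).detectProb ρ *
        ∏ t, (ketbra ((Fin.cons (w ω r) v : Fin (k + 1) → ι → ℂ) t) * ρ).trace.re) π :=
      integrable_of_ae_mem_pureStates hπ
        ((next ω).continuous_detectProb.mul (continuous_prod_trace_ketbra_mul _))
    simp only [detectProb_measure_mul_prod M next hw, Finset.mul_sum]
    rw [integral_finsetSum _ fun ω _ => integrable_finsetSum _ fun r _ => hint ω r]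
    refine Finset.sum_le_sum fun ω _ => ?_
    rw [integral_finsetSum _ fun r _ => hint ω r]
    exact Finset.sum_le_sum fun r _ => ih ω (by lia) _

theorem DominatesMoments.detectProb_le {T : ℕ} (hdom : DominatesMoments π σ T c)
    (hπ : ∀ᵐ ρ ∂π, ρ ∈ pureStates ι) (P : SingleCopyProtocol ι T) :
    c * P.detectProb σ ≤ ∫ ρ, P.detectProb ρ ∂π := by
  simpa using hdom.detectProb_mul_prod_le hπ P (zero_add T).le Fin.elim0

end MomentDomination

section HaarMoments

theorem pow_div_ascFactorial_le_one (D k : ℕ) : (D : ℝ) ^ k / D.ascFactorial k ≤ 1 :=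
  div_le_one_of_le₀ (by exact_mod_cast D.pow_succ_le_ascFactorial k) (Nat.cast_nonneg _)

theorem one_sub_sq_div_le_pow_div_ascFactorial {D : ℕ} (hD : 0 < D) (k : ℕ) :
    1 - (k : ℝ) ^ 2 / (2 * D) ≤ (D : ℝ) ^ k / D.ascFactorial k := by
  induction k with
  | zero => simp
  | succ k ih =>
    have hfactor : (D : ℝ) ^ k / D.ascFactorial k - k / D ≤
        (D : ℝ) ^ (k + 1) / D.ascFactorial (k + 1) := by
      have hsplit : (D : ℝ) ^ (k + 1) / D.ascFactorial (k + 1) =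
          (D : ℝ) ^ k / D.ascFactorial k -
            (D : ℝ) ^ k / D.ascFactorial k * (k / (D + k)) := by
        rw [Nat.ascFactorial_succ]
        push_cast
        have : (D.ascFactorial k : ℝ) ≠ 0 := by
          exact_mod_cast ((pow_pos hD k).trans_le (D.pow_succ_le_ascFactorial k)).ne'
        field_simp
        ring
      have hle : (D : ℝ) ^ k / D.ascFactorial k * (k / (D + k)) ≤ 1 * (k / D) := by
        gcongr
        · exact pow_div_ascFactorial_le_one D k
        · exact le_add_of_nonneg_right (Nat.cast_nonneg k)
      linarith
    have hquad : ((k + 1 : ℕ) : ℝ) ^ 2 / (2 * D) = (k : ℝ) ^ 2 / (2 * D) + k / D + 1 / (2 * D) := by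
      push_cast
      field_simp
      ring
    have : 0 ≤ 1 / (2 * (D : ℝ)) := by positivity
    linarith

theorem mul_div_le_of_le_div_of_le_mul {c p q s I : ℝ} (hp : 0 < p) (hq : 0 < q) (hc : c ≤ p / q)
    (hs : 0 ≤ s) (hle : s ≤ q * I) : c * (s / p) ≤ I :=
  calc c * (s / p) ≤ p / q * (s / p) := by gcongr
    _ = s / q := by field_simp
    _ ≤ I := (div_le_iff₀' hq).mpr hle

theorem trace_ketbra_mul_ketbra {ι : Type} [Fintype ι] (v x : ι → ℂ) :
    (ketbra v * ketbra x).trace.re = Complex.normSq (star v ⬝ᵥ x) := by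
  rw [ketbra, ketbra, vecMulVec_mul_vecMulVec, trace_vecMulVec, dotProduct_smul,
    dotProduct_comm v, star_dotProduct x v, smul_eq_mul, Complex.star_def, Complex.mul_conj,
    Complex.ofReal_re]

variable (ι : Type) [Fintype ι] [DecidableEq ι]

/-- The maximally mixed state `𝟙 / dim`. -/
noncomputable def maximallyMixed : Matrix ι ι ℂ := (Fintype.card ι : ℂ)⁻¹ • 1

variable {ι}

theorem isDensity_maximallyMixed [Nonempty ι] : IsDensity (maximallyMixed ι) := by
  refine ⟨PosSemidef.one.smul (by positivity), ?_⟩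
  rw [maximallyMixed, trace_smul, trace_one, smul_eq_mul, inv_mul_cancel₀]
  exact_mod_cast Fintype.card_ne_zero

theorem trace_ketbra_mul_maximallyMixed (v : ι → ℂ) :
    (ketbra v * maximallyMixed ι).trace.re = (∑ i, Complex.normSq (v i)) / Fintype.card ι := by
  rw [maximallyMixed, mul_smul_comm, mul_one, trace_smul, ketbra, trace_vecMulVec,
    dotProduct_comm, dotProduct_star_self_eq_sum_normSq, smul_eq_mul, div_eq_inv_mul,
    ← Complex.ofReal_natCast, ← Complex.ofReal_inv, ← Complex.ofReal_mul, Complex.ofReal_re]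

theorem dominatesMoments_haarState [Nonempty ι] (T : ℕ) :
    DominatesMoments (haarState ι) (maximallyMixed ι) T
      (1 - (T : ℝ) ^ 2 / (2 * Fintype.card ι)) := by
  intro k hk v
  rw [integral_haarState (continuous_prod_trace_ketbra_mul v)]
  simp only [trace_ketbra_mul_ketbra, trace_ketbra_mul_maximallyMixed, Finset.prod_div_distrib,
    Finset.prod_const, Finset.card_univ, Fintype.card_fin]
  refine mul_div_le_of_le_div_of_le_mul ?_ ?_ ?_ (Finset.prod_nonneg fun t _ =>
    Finset.sum_nonneg fun i _ => Complex.normSq_nonneg _)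
    (by simpa using prod_sum_normSq_le_ascFactorial_mul_integral Finset.univ v)
  · exact pow_pos (by exact_mod_cast Fintype.card_pos) k
  · exact_mod_cast (pow_pos Fintype.card_pos k).trans_le (Nat.pow_succ_le_ascFactorial _ k)
  · refine le_trans ?_ (one_sub_sq_div_le_pow_div_ascFactorial Fintype.card_pos k)
    gcongr

variable {A B : Type} [Fintype A] [Fintype B] [DecidableEq B] [Nonempty B]

theorem prod_sum_normSq_le_integral_haarVector_right {κ : Type} [Fintype κ] (v : κ → A × B → ℂ)
    (x : A → ℂ) :
    ∏ t, ∑ b, Complex.normSq (star (fun a => v t (a, b)) ⬝ᵥ x) ≤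
      (Fintype.card B).ascFactorial (Fintype.card κ) *
        ∫ y, ∏ t, Complex.normSq (star (v t) ⬝ᵥ fun p : A × B => x p.1 * y p.2) ∂haarVector B := by
  have h := prod_sum_normSq_le_ascFactorial_mul_integral Finset.univ
    fun t b => star x ⬝ᵥ fun a => v t (a, b)
  have hdot (t : κ) (y : B → ℂ) : star (fun b => star x ⬝ᵥ fun a => v t (a, b)) ⬝ᵥ y =
      star (v t) ⬝ᵥ fun p : A × B => x p.1 * y p.2 := by
    simp only [dotProduct, Pi.star_apply, star_sum, star_mul', star_star, Finset.sum_mul,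
      Fintype.sum_prod_type_right]
    exact Finset.sum_congr rfl fun b _ => Finset.sum_congr rfl fun a _ => by ring
  simp only [hdot] at h
  simpa only [star_dotProduct x, Complex.star_def, Complex.normSq_conj, Finset.card_univ] using h

variable [DecidableEq A] [Nonempty A]

theorem prod_sum_normSq_le_integral_haarVector_prod {κ : Type} [Fintype κ] (v : κ → A × B → ℂ) :
    ∏ t, ∑ p, Complex.normSq (v t p) ≤
      (Fintype.card A).ascFactorial (Fintype.card κ) *
        ((Fintype.card B).ascFactorial (Fintype.card κ) *
        ∫ x, ∫ y, ∏ t, Complex.normSq (star (v t) ⬝ᵥ fun p : A × B => x p.1 * y p.2)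
          ∂haarVector B ∂haarVector A) := by
  classical
  have hint : Integrable (fun x => ∫ y, ∏ t, Complex.normSq
      (star (v t) ⬝ᵥ fun p : A × B => x p.1 * y p.2) ∂haarVector B) (haarVector A) :=
    (integrable_haarVector_prod (f := fun z => ∏ t, Complex.normSq
      (star (v t) ⬝ᵥ fun p : A × B => z.1 p.1 * z.2 p.2)) (by fun_prop)).integral_prod_left
  calc ∏ t, ∑ p, Complex.normSq (v t p)
    _ = ∑ β : κ → B, ∏ t, ∑ a, Complex.normSq (v t (a, β t)) := by
      simp only [Fintype.sum_prod_type_right, Fintype.prod_sum]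
    _ ≤ ∑ β : κ → B, (Fintype.card A).ascFactorial (Fintype.card κ) *
        ∫ x, ∏ t, Complex.normSq (star (fun a => v t (a, β t)) ⬝ᵥ x) ∂haarVector A :=
      Finset.sum_le_sum fun β _ =>
        prod_sum_normSq_le_ascFactorial_mul_integral Finset.univ fun t a => v t (a, β t)
    _ = (Fintype.card A).ascFactorial (Fintype.card κ) *
        ∫ x, ∏ t, ∑ b, Complex.normSq (star (fun a => v t (a, b)) ⬝ᵥ x) ∂haarVector A := by
      rw [← Finset.mul_sum, ← integral_finsetSum _ fun β _ =>
        integrable_haarVector (by fun_prop)]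
      simp only [Fintype.prod_sum]
    _ ≤ _ := by
      refine mul_le_mul_of_nonneg_left ?_ (Nat.cast_nonneg _)
      rw [← integral_const_mul]
      exact integral_mono (integrable_haarVector (by fun_prop)) (hint.const_mul _)
        (prod_sum_normSq_le_integral_haarVector_right v)

theorem dominatesMoments_haarProductState (T : ℕ) :
    DominatesMoments (haarProductState A B) (maximallyMixed (A × B)) T
      (1 - (T : ℝ) ^ 2 / (2 * Fintype.card A) - (T : ℝ) ^ 2 / (2 * Fintype.card B)) := by
  intro k hk v
  rw [integral_haarProductState (continuous_prod_trace_ketbra_mul v)]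
  simp only [trace_ketbra_mul_ketbra, trace_ketbra_mul_maximallyMixed, Finset.prod_div_distrib,
    Finset.prod_const, Finset.card_univ, Fintype.card_fin]
  have hA := one_sub_sq_div_le_pow_div_ascFactorial (D := Fintype.card A) Fintype.card_pos k
  have hB := one_sub_sq_div_le_pow_div_ascFactorial (D := Fintype.card B) Fintype.card_pos k
  have hA₁ := pow_div_ascFactorial_le_one (Fintype.card A) k
  have hB₁ := pow_div_ascFactorial_le_one (Fintype.card B) k
  refine mul_div_le_of_le_div_of_le_mul (q := (Fintype.card A).ascFactorial k *
    (Fintype.card B).ascFactorial k) ?_ ?_ ?_ (Finset.prod_nonneg fun t _ =>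
    Finset.sum_nonneg fun i _ => Complex.normSq_nonneg _) ?_
  · exact pow_pos (by exact_mod_cast Fintype.card_pos) k
  · exact_mod_cast mul_pos
      ((pow_pos Fintype.card_pos k).trans_le (Nat.pow_succ_le_ascFactorial _ k))
      ((pow_pos Fintype.card_pos k).trans_le (Nat.pow_succ_le_ascFactorial _ k))
  · have hTk : (k : ℝ) ^ 2 ≤ (T : ℝ) ^ 2 := by gcongr
    have hTA : (k : ℝ) ^ 2 / (2 * Fintype.card A) ≤ (T : ℝ) ^ 2 / (2 * Fintype.card A) := by gcongr
    have hTB : (k : ℝ) ^ 2 / (2 * Fintype.card B) ≤ (T : ℝ) ^ 2 / (2 * Fintype.card B) := by gcongr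
    rw [Fintype.card_prod, Nat.cast_mul, mul_pow, mul_div_mul_comm]
    nlinarith [mul_nonneg (sub_nonneg.mpr hA₁) (sub_nonneg.mpr hB₁)]
  · simpa [mul_assoc] using prod_sum_normSq_le_integral_haarVector_prod v

end HaarMoments

section LowerBound

variable {m : ℕ} [NeZero m] {T : ℕ}

theorem integral_haarState_sub_integral_haarProductState_le
    (P : SingleCopyProtocol (Fin m × Fin m) T) :
    ∫ ρ, P.detectProb ρ ∂haarState (Fin m × Fin m) -
      ∫ ρ, P.detectProb ρ ∂haarProductState (Fin m) (Fin m) ≤ (T : ℝ) ^ 2 / m := by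
  have hm : (1 : ℝ) ≤ m := by exact_mod_cast NeZero.one_le
  set σ := maximallyMixed (Fin m × Fin m)
  have hσ : IsDensity σ := isDensity_maximallyMixed
  have hhaar := (dominatesMoments_haarState T).detectProb_le ae_haarState_mem_pureStates P.compl
  have hprod := (dominatesMoments_haarProductState T).detectProb_le
    ae_haarProductState_mem_pureStates P
  have hcompl : ∫ ρ, P.compl.detectProb ρ ∂haarState (Fin m × Fin m) =
      1 - ∫ ρ, P.detectProb ρ ∂haarState (Fin m × Fin m) := by
    rw [integral_congr_ae (ae_haarState_mem_pureStates.mono fun ρ hρ =>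
      P.detectProb_compl (isDensity_of_mem_pureStates hρ).2), integral_sub (integrable_const _)
      (integrable_of_ae_mem_pureStates ae_haarState_mem_pureStates P.continuous_detectProb)]
    simp
  rw [hcompl, P.detectProb_compl hσ.2] at hhaar
  simp only [Fintype.card_prod, Fintype.card_fin, Nat.cast_mul] at hhaar hprod
  have hsq : (T : ℝ) ^ 2 / (2 * (m * m)) ≤ (T : ℝ) ^ 2 / (2 * m) := by
    gcongr
    exact le_mul_of_one_le_left (by positivity) hm
  have hhalf : (T : ℝ) ^ 2 / m = (T : ℝ) ^ 2 / (2 * m) + (T : ℝ) ^ 2 / (2 * m) := by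
    field_simp
    ring
  have hpos : 0 ≤ (T : ℝ) ^ 2 / (2 * m) := by positivity
  nlinarith [P.detectProb_nonneg hσ, P.detectProb_le_one hσ]

theorem le_three_mul_sq_of_completeness_of_soundness (P : SingleCopyProtocol (Fin m × Fin m) T)
    (hcomplete : 1 / 4 ≤ completeness (taskLaw m) P.detectProb)
    (hsound : 5 / 6 ≤ soundness (taskLaw m) P.detectProb) : (m : ℝ) ≤ 3 * (T : ℝ) ^ 2 := by
  have hm : (0 : ℝ) < m := by exact_mod_cast NeZero.pos m
  have hent := setIntegral_entangled_taskLaw_le P.continuous_detectProb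
    fun ρ hρ => P.detectProb_nonneg (isDensity_of_mem_pureStates hρ)
  have hdiff := integral_haarState_sub_integral_haarProductState_le P
  have hsound' : 5 / 6 * completeness (taskLaw m) P.detectProb ≤
      ∫ ρ in entangled (Fin m) (Fin m), P.detectProb ρ ∂taskLaw m :=
    (le_div_iff₀ (hcomplete.trans_lt' (by norm_num))).mp hsound
  rw [completeness_taskLaw P.continuous_detectProb] at hcomplete hsound'
  have : 1 / 3 ≤ (T : ℝ) ^ 2 / m := by linarith
  rw [le_div_iff₀ hm] at this
  linarith

end LowerBound

section Purity

variable {ι A B : Type} [Fintype ι] [Fintype A] [Fintype B]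

/-- The purity `Tr (ρ ^ 2)`. -/
noncomputable def purity (ρ : Matrix ι ι ℂ) : ℝ := (ρ * ρ).trace.re

/-- The reduced state `ρ_A`, the partial trace of `ρ` over the second subsystem. -/
noncomputable def reducedA {A B : Type} [Fintype B] (ρ : Matrix (A × B) (A × B) ℂ) :
    Matrix A A ℂ :=
  ∑ b, ρ.submatrix (·, b) (·, b)

theorem reducedA_apply {A : Type} (ρ : Matrix (A × B) (A × B) ℂ) (a a' : A) :
    reducedA ρ a a' = ∑ b, ρ (a, b) (a', b) := by
  simp only [reducedA, Matrix.sum_apply, submatrix_apply]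

theorem trace_reducedA (ρ : Matrix (A × B) (A × B) ℂ) : (reducedA ρ).trace = ρ.trace := by
  simp only [Matrix.trace, diag_apply, reducedA_apply, Fintype.sum_prod_type]

theorem isDensity_reducedA {ρ : Matrix (A × B) (A × B) ℂ} (hρ : IsDensity ρ) :
    IsDensity (reducedA ρ) :=
  ⟨posSemidef_sum _ fun b _ => hρ.1.submatrix (·, b), by rw [trace_reducedA, hρ.2]⟩

theorem coe_purity {ρ : Matrix ι ι ℂ} (hρ : ρ.IsHermitian) :
    (purity ρ : ℂ) = (ρ * ρ).trace := by
  rw [purity, ← Complex.conj_eq_iff_re, ← Complex.star_def, ← trace_conjTranspose,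
    conjTranspose_mul, hρ.eq]

theorem purity_eq_sum_normSq {ρ : Matrix ι ι ℂ} (hρ : ρ.IsHermitian) :
    purity ρ = ∑ i, ∑ j, Complex.normSq (ρ i j) := by
  rw [← Complex.ofReal_inj, coe_purity hρ]
  simp only [Matrix.trace, diag_apply, Matrix.mul_apply, Complex.ofReal_sum, ← Complex.mul_conj]
  exact Finset.sum_congr rfl fun i _ => Finset.sum_congr rfl fun j _ => by
    rw [← hρ.apply j i, Complex.star_def]

theorem inv_card_le_purity {ρ : Matrix ι ι ℂ} (hρ : ρ.IsHermitian) (htr : ρ.trace = 1) :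
    (Fintype.card ι : ℝ)⁻¹ ≤ purity ρ := by
  have hdiag : ∑ i, (ρ i i).re ^ 2 ≤ purity ρ := by
    rw [purity_eq_sum_normSq hρ]
    refine Finset.sum_le_sum fun i _ => le_trans ?_ (Finset.single_le_sum
      (f := fun j => Complex.normSq (ρ i j)) (fun _ _ => Complex.normSq_nonneg _)
      (Finset.mem_univ i))
    rw [Complex.normSq_apply, sq]
    exact le_add_of_nonneg_right (mul_self_nonneg _)
  have hsum : ∑ i, (ρ i i).re = 1 := by
    rw [← Complex.re_sum, ← Complex.one_re, ← htr]
    rfl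
  have hcauchy := sq_sum_le_card_mul_sum_sq (s := Finset.univ) (f := fun i => (ρ i i).re)
  rw [hsum, Finset.card_univ, one_pow] at hcauchy
  rw [← one_div]
  refine div_le_of_le_mul₀ (Nat.cast_nonneg _)
    ((Finset.sum_nonneg fun _ _ => sq_nonneg _).trans hdiag) (hcauchy.trans ?_)
  rw [mul_comm]
  gcongr

theorem normSq_star_dotProduct_le (v w : ι → ℂ) : Complex.normSq (star v ⬝ᵥ w) ≤
    (∑ i, Complex.normSq (v i)) * ∑ i, Complex.normSq (w i) := by
  simp only [Complex.normSq_eq_norm_sq, dotProduct, Pi.star_apply]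
  calc ‖∑ i, star (v i) * w i‖ ^ 2 ≤ (∑ i, ‖v i‖ * ‖w i‖) ^ 2 := by
        gcongr
        exact (norm_sum_le _ _).trans_eq (by simp only [norm_mul, norm_star])
    _ ≤ _ := Finset.sum_mul_sq_le_sq_mul_sq _ _ _

theorem trace_ketbra_re (v : ι → ℂ) : (ketbra v).trace.re = ∑ i, Complex.normSq (v i) := by
  rw [ketbra, trace_vecMulVec, dotProduct_comm, dotProduct_star_self_eq_sum_normSq,
    Complex.ofReal_re]

theorem trace_mul_le {ρ τ : Matrix ι ι ℂ} (hρ : ρ.PosSemidef) (hτ : τ.PosSemidef) :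
    (ρ * τ).trace.re ≤ ρ.trace.re * τ.trace.re := by
  obtain ⟨n, v, rfl⟩ := posSemidef_iff_eq_sum_vecMulVec.mp hρ
  obtain ⟨k, w, rfl⟩ := posSemidef_iff_eq_sum_vecMulVec.mp hτ
  simp only [Finset.sum_mul_sum, trace_sum, Complex.re_sum]
  refine Finset.sum_le_sum fun i _ => Finset.sum_le_sum fun j _ => ?_
  rw [← ketbra, ← ketbra, trace_ketbra_mul_ketbra, trace_ketbra_re, trace_ketbra_re]
  exact normSq_star_dotProduct_le (v i) (w j)

theorem purity_le_one {ρ : Matrix ι ι ℂ} (hρ : IsDensity ρ) : purity ρ ≤ 1 := by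
  simpa [purity, hρ.2] using trace_mul_le hρ.1 hρ.1

theorem purity_of_mem_pureStates {ρ : Matrix ι ι ℂ} (hρ : ρ ∈ pureStates ι) : purity ρ = 1 := by
  have htr := (isDensity_of_mem_pureStates hρ).2
  obtain ⟨ψ, hψ, rfl⟩ := hρ
  rw [unitVectors, Set.mem_ofPred_eq] at hψ
  have hidem : ketbra ψ * ketbra ψ = ketbra ψ := by
    rw [ketbra, vecMulVec_mul_vecMulVec, hψ, one_smul]
  rw [purity, hidem, htr, Complex.one_re]

theorem reducedA_sum_smul_kronecker {A κ : Type} [Fintype κ] (p : κ → ℂ)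
    (ρA : κ → Matrix A A ℂ) {ρB : κ → Matrix B B ℂ} (hB : ∀ i, (ρB i).trace = 1) :
    reducedA (∑ i, p i • (ρA i ⊗ₖ ρB i)) = ∑ i, p i • ρA i := by
  ext a a'
  simp only [reducedA_apply, Matrix.sum_apply, Matrix.smul_apply, kroneckerMap_apply, smul_eq_mul]
  rw [Finset.sum_comm]
  refine Finset.sum_congr rfl fun i _ => ?_
  have htr := hB i
  simp only [Matrix.trace, diag_apply] at htr
  rw [← Finset.mul_sum, ← Finset.mul_sum, htr, mul_one]

theorem IsSeparable.purity_le_purity_reducedA {ρ : Matrix (A × B) (A × B) ℂ}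
    (hρ : IsSeparable ρ) : purity ρ ≤ purity (reducedA ρ) := by
  obtain ⟨k, p, ρA, ρB, hp, -, hA, hB, rfl⟩ := hρ
  rw [reducedA_sum_smul_kronecker _ _ fun i => (hB i).2]
  simp only [purity, Finset.sum_mul_sum, trace_sum, Matrix.smul_mul, Matrix.mul_smul, trace_smul,
    ← mul_kronecker_mul, trace_kronecker, Complex.re_sum, smul_eq_mul, Complex.re_ofReal_mul]
  refine Finset.sum_le_sum fun i _ => Finset.sum_le_sum fun j _ =>
    mul_le_mul_of_nonneg_left (mul_le_mul_of_nonneg_left ?_ (hp _)) (hp _)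
  have hAB := Complex.le_def.mp (trace_mul_nonneg (hA i).1 (hA j).1)
  have hBB := trace_mul_le (hB i).1 (hB j).1
  rw [(hB i).2, (hB j).2, Complex.one_re, mul_one] at hBB
  rw [Complex.mul_re, ← hAB.2, Complex.zero_im, zero_mul, sub_zero]
  exact mul_le_of_le_one_right hAB.1 hBB

theorem IsSeparable.purity_reducedA_eq_one {ρ : Matrix (A × B) (A × B) ℂ} (hsep : IsSeparable ρ)
    (hρ : ρ ∈ pureStates (A × B)) : purity (reducedA ρ) = 1 :=
  le_antisymm (purity_le_one (isDensity_reducedA (isDensity_of_mem_pureStates hρ)))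
    ((purity_of_mem_pureStates hρ).symm.trans_le hsep.purity_le_purity_reducedA)

end Purity

section SwapTest

variable {ι A B : Type} [Fintype ι] [Fintype A] [Fintype B]

theorem sum_prod_pair {N : ℕ} (F : Fin N → ι × ι → ℂ) :
    ∑ z : Fin (N * 2) → ι, ∏ j, F j (pair j z) = ∏ j, ∑ w, F j w := by
  classical
  rw [Fintype.prod_sum]
  exact Fintype.sum_equiv (pairEquiv ι N) _ _ fun _ => rfl

theorem trace_tensorPower (ρ : Matrix ι ι ℂ) (T : ℕ) :
    (tensorPower ρ T).trace = ρ.trace ^ T := by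
  simp only [Matrix.trace, diag_apply, tensorPower, of_apply]
  rw [← Fintype.prod_sum fun (_ : Fin T) i => ρ i i, Finset.prod_const, Finset.card_univ,
    Fintype.card_fin]

theorem tensorPower_mul_two_apply {ι : Type} (ρ : Matrix ι ι ℂ) {N : ℕ} (x y : Fin (N * 2) → ι) :
    tensorPower ρ (N * 2) x y = ∏ j, (ρ ⊗ₖ ρ) (pair j x) (pair j y) := by
  simp only [tensorPower, of_apply]
  rw [← Fintype.prod_equiv finProdFinEquiv (fun c => ρ (x (finProdFinEquiv c))
    (y (finProdFinEquiv c))) _ fun _ => rfl, Fintype.prod_prod_type]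
  simp only [Fin.prod_univ_two, pair, kroneckerMap_apply]

variable [DecidableEq A] [DecidableEq B] {ρ : Matrix (A × B) (A × B) ℂ}

theorem trace_swapA_mul (ρ : Matrix (A × B) (A × B) ℂ) :
    (swapA A B * (ρ ⊗ₖ ρ)).trace = (reducedA ρ * reducedA ρ).trace := by
  have hperm : (swapA A B * (ρ ⊗ₖ ρ)).trace =
      ∑ y : (A × B) × (A × B), ρ y.1 (y.2.1, y.1.2) * ρ y.2 (y.1.1, y.2.2) := by
    simp only [Matrix.trace, diag_apply, Matrix.mul_apply, swapA, of_apply, ite_mul,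
      one_mul, zero_mul]
    rw [Finset.sum_comm]
    simp [kroneckerMap_apply]
  rw [hperm]
  simp only [Matrix.trace, diag_apply, Matrix.mul_apply, reducedA_apply,
    Fintype.sum_prod_type, Finset.sum_mul_sum]
  exact Finset.sum_congr rfl fun a _ => Finset.sum_comm

theorem trace_swapEffect_true_mul (hρ : IsDensity ρ) :
    (swapEffect A B true * (ρ ⊗ₖ ρ)).trace = ((1 + purity (reducedA ρ)) / 2 : ℝ) := by
  push_cast
  rw [coe_purity (isDensity_reducedA hρ).1.isHermitian, div_eq_inv_mul]
  simp only [swapEffect, sign, if_true, Complex.ofReal_one, one_smul, Matrix.smul_mul,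
    Matrix.add_mul, Matrix.one_mul, trace_smul, trace_add, trace_kronecker, hρ.2, trace_swapA_mul,
    smul_eq_mul, mul_one]

theorem prob_swapTestPOVM (N : ℕ) (ρ : Matrix (A × B) (A × B) ℂ) (s : Fin N → Bool) :
    (swapTestPOVM A B N).prob (tensorPower ρ (N * 2)) s =
      (∏ j, (swapEffect A B (s j) * (ρ ⊗ₖ ρ)).trace).re := by
  rw [POVM.prob]
  congr 1
  simp only [Matrix.trace, diag_apply, Matrix.mul_apply, tensorPower_mul_two_apply, swapTestPOVM,
    of_apply, ← Finset.prod_mul_distrib]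
  rw [← sum_prod_pair fun j u => ∑ v, swapEffect A B (s j) u v * (ρ ⊗ₖ ρ) v u]
  exact Finset.sum_congr rfl fun x _ => sum_prod_pair fun j v =>
    swapEffect A B (s j) (pair j x) v * (ρ ⊗ₖ ρ) v (pair j x)

theorem swapTest_estimator_neg_iff {N : ℕ} [NeZero N] (s : Fin N → Bool) :
    (swapTestProtocol A B N).estimator s < 0 ↔ s ≠ fun _ => true := by
  have hN : (0 : ℝ) < N := by exact_mod_cast NeZero.pos N
  have hiff : (swapTestProtocol A B N).estimator s < 0 ↔ ∑ j, sign (s j) < N := by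
    simp only [swapTestProtocol, sub_neg, div_lt_one hN]
  rw [hiff]
  have hle (b) : sign b ≤ 1 := by cases b <;> norm_num [sign]
  constructor
  · rintro h rfl
    simp [sign] at h
  · intro h
    obtain ⟨j, hj⟩ := Function.ne_iff.mp h
    calc ∑ j, sign (s j) < ∑ _j : Fin N, (1 : ℝ) :=
          Finset.sum_lt_sum (fun i _ => hle _) ⟨j, Finset.mem_univ j, by
            rw [Bool.eq_false_iff.mpr hj]; norm_num [sign]⟩
      _ = N := by simp

theorem detectProb_swapTestProtocol {N : ℕ} [NeZero N] (hρ : IsDensity ρ) :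
    (swapTestProtocol A B N).detectProb ρ = 1 - ((1 + purity (reducedA ρ)) / 2) ^ N := by
  have hsum := (swapTestPOVM A B N).sum_prob (ρ := tensorPower ρ (N * 2))
    (by rw [trace_tensorPower, hρ.2, one_pow])
  have haccept : (swapTestPOVM A B N).prob (tensorPower ρ (N * 2)) (fun _ => true) =
      ((1 + purity (reducedA ρ)) / 2) ^ N := by
    rw [prob_swapTestPOVM, trace_swapEffect_true_mul hρ, Finset.prod_const, Finset.card_univ,
      Fintype.card_fin, ← Complex.ofReal_pow, Complex.ofReal_re]
  have hdetect : (swapTestProtocol A B N).detectProb ρ = ∑ s : Fin N → Bool,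
      if s = fun _ => true then 0 else (swapTestPOVM A B N).prob (tensorPower ρ (N * 2)) s :=
    Finset.sum_congr rfl fun s _ => by
      by_cases hs : s = fun _ => true
      · exact (if_neg fun hneg => (swapTest_estimator_neg_iff s).mp hneg hs).trans (if_pos hs).symm
      · exact (if_pos ((swapTest_estimator_neg_iff s).mpr hs)).trans (if_neg hs).symm
  rw [← haccept, eq_sub_iff_add_eq, ← hsum, hdetect,
    ← Fintype.sum_ite_eq' (fun _ => true) ((swapTestPOVM A B N).prob (tensorPower ρ (N * 2))),
    ← Finset.sum_add_distrib]
  exact Finset.sum_congr rfl fun s _ => by split_ifs <;> simp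

end SwapTest

section Minors

variable {ι : Type}

/-- The two by two minor `xᵢ xⱼ - xₖ xₗ`. -/
noncomputable def minorPoly (i j k l : ι) : MvPolynomial ι ℂ := X i * X j - X k * X l

/-- The differential operator `∂ᵢ ∂ⱼ - ∂ₖ ∂ₗ`, which is adjoint to multiplication by
`minorPoly i j k l` up to a scalar. -/
noncomputable def minorDeriv (i j k l : ι) (g : MvPolynomial ι ℂ) : MvPolynomial ι ℂ :=
  pderiv j (pderiv i g) - pderiv l (pderiv k g)

theorem eval_minorPoly (x : ι → ℂ) (i j k l : ι) :
    eval x (minorPoly i j k l) = x i * x j - x k * x l := by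
  simp only [minorPoly, map_sub, map_mul, eval_X]

theorem isHomogeneous_minorPoly (i j k l : ι) : (minorPoly i j k l).IsHomogeneous 2 :=
  ((isHomogeneous_X ℂ i).mul (isHomogeneous_X ℂ j)).sub
    ((isHomogeneous_X ℂ k).mul (isHomogeneous_X ℂ l))

variable {i j k l : ι}

theorem pderiv_minorPoly (h : [i, j, k, l].Nodup) :
    pderiv i (minorPoly i j k l) = X j ∧ pderiv j (minorPoly i j k l) = X i ∧
      pderiv k (minorPoly i j k l) = -X l ∧ pderiv l (minorPoly i j k l) = -X k := by
  classical
  simp only [List.nodup_cons, List.mem_cons, List.not_mem_nil, or_false, not_or] at h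
  obtain ⟨⟨hij, hik, hil⟩, ⟨hjk, hjl⟩, hkl, -⟩ := h
  refine ⟨?_, ?_, ?_, ?_⟩ <;>
  simp [minorPoly, pderiv_X, hij, hik, hil, hjk, hjl, hkl, Ne.symm hij, Ne.symm hik, Ne.symm hil,
    Ne.symm hjk, Ne.symm hjl, Ne.symm hkl]

theorem minorDeriv_minorPoly (h : [i, j, k, l].Nodup) :
    minorDeriv i j k l (minorPoly i j k l) = 2 := by
  obtain ⟨hi, -, hk, -⟩ := pderiv_minorPoly h
  rw [minorDeriv, hi, hk, map_neg, pderiv_X_self, pderiv_X_self]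
  norm_num

theorem minorDeriv_minorPoly_sq (h : [i, j, k, l].Nodup) :
    minorDeriv i j k l (minorPoly i j k l ^ 2) = 6 * minorPoly i j k l := by
  obtain ⟨hi, hj, hk, hl⟩ := pderiv_minorPoly h
  simp only [minorDeriv, sq, pderiv_mul, map_add, map_neg, hi, hj, hk, hl, pderiv_X_self]
  simp only [minorPoly]
  ring

variable [Fintype ι] [DecidableEq ι] [Nonempty ι]

theorem polyInner_minorPoly_mul {f : MvPolynomial ι ℂ} {n : ℕ} (hf : f.IsHomogeneous n)
    (i j k l : ι) (g : MvPolynomial ι ℂ) :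
    ((Fintype.card ι + n : ℕ) : ℂ) * ((Fintype.card ι + n + 1 : ℕ) : ℂ) *
      polyInner (minorPoly i j k l * f) g = polyInner f (minorDeriv i j k l g) := by
  have hmonomial (a b : ι) : ((Fintype.card ι + n : ℕ) : ℂ) * ((Fintype.card ι + n + 1 : ℕ) : ℂ) *
      polyInner (X a * X b * f) g = polyInner f (pderiv b (pderiv a g)) := by
    rw [← polyInner_X_mul hf, ← polyInner_X_mul ((isHomogeneous_X ℂ b).mul hf), mul_assoc,
      mul_assoc (X a), add_assoc _ n 1, add_comm n 1]
  rw [minorPoly, sub_mul, map_sub, LinearMap.sub_apply, mul_sub, hmonomial, hmonomial, minorDeriv,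
    map_sub]

theorem integral_normSq_minorPoly (h : [i, j, k, l].Nodup) :
    ∫ x, Complex.normSq (eval x (minorPoly i j k l)) ∂haarVector ι =
      2 / (Fintype.card ι * (Fintype.card ι + 1)) := by
  have hmoment := polyInner_minorPoly_mul (isHomogeneous_one ι ℂ) i j k l (minorPoly i j k l)
  rw [minorDeriv_minorPoly h, mul_one, polyInner_self, polyInner_apply] at hmoment
  simp only [map_one, map_ofNat, one_mul, integral_const, probReal_univ, one_smul, add_zero]
    at hmoment
  rw [eq_div_iff (by positivity), mul_comm]
  exact_mod_cast hmoment

theorem integral_normSq_minorPoly_sq (h : [i, j, k, l].Nodup) :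
    ∫ x, Complex.normSq (eval x (minorPoly i j k l)) ^ 2 ∂haarVector ι =
      6 / ((Fintype.card ι + 2) * (Fintype.card ι + 3)) *
        ∫ x, Complex.normSq (eval x (minorPoly i j k l)) ∂haarVector ι := by
  have hmoment := polyInner_minorPoly_mul (isHomogeneous_minorPoly i j k l) i j k l
    (minorPoly i j k l ^ 2)
  have hsix : (6 : MvPolynomial ι ℂ) * minorPoly i j k l = (6 : ℂ) • minorPoly i j k l := by
    rw [smul_eq_C_mul, map_ofNat]
  rw [minorDeriv_minorPoly_sq h, hsix, LinearMap.map_smulₛₗ, ← sq, polyInner_self,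
    polyInner_self] at hmoment
  simp only [map_pow, map_ofNat, smul_eq_mul, add_assoc] at hmoment
  rw [div_mul_eq_mul_div, eq_div_iff (by positivity), mul_comm]
  norm_num at hmoment
  exact_mod_cast hmoment

end Minors

section MeanPurity

variable {A B : Type} [Fintype A] [Fintype B]

theorem trace_reducedA_ketbra_mul_self (ψ : A × B → ℂ) :
    (reducedA (ketbra ψ) * reducedA (ketbra ψ)).trace =
      ∑ a, ∑ a', ∑ b, ∑ b', ψ (a, b) * ψ (a', b') * conj (ψ (a, b') * ψ (a', b)) := by
  simp only [Matrix.trace, diag_apply, Matrix.mul_apply, reducedA_apply, ketbra,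
    vecMulVec_apply, Pi.star_apply, Complex.star_def, Finset.sum_mul_sum, map_mul]
  exact Finset.sum_congr rfl fun a _ => Finset.sum_congr rfl fun a' _ =>
    Finset.sum_congr rfl fun b _ => Finset.sum_congr rfl fun b' _ => by ring

theorem purity_reducedA_ketbra {ψ : A × B → ℂ} (hψ : ψ ∈ unitVectors (A × B)) :
    purity (reducedA (ketbra ψ)) = 1 - (∑ a, ∑ a', ∑ b, ∑ b',
      Complex.normSq (eval ψ (minorPoly (a, b) (a', b') (a, b') (a', b)))) / 2 := by
  have hswap (F : A → A → B → B → ℝ) :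
      ∑ a, ∑ a', ∑ b, ∑ b', F a a' b' b = ∑ a, ∑ a', ∑ b, ∑ b', F a a' b b' :=
    Finset.sum_congr rfl fun a _ => Finset.sum_congr rfl fun a' _ => Finset.sum_comm
  have hnorm : ∑ a, ∑ a', ∑ b, ∑ b', Complex.normSq (ψ (a, b) * ψ (a', b')) = 1 := by
    rw [mem_unitVectors, Fintype.sum_prod_type] at hψ
    simp only [Complex.normSq_mul, ← Finset.sum_mul_sum, hψ, mul_one]
  have hcross : ∑ a, ∑ a', ∑ b, ∑ b',
      (ψ (a, b) * ψ (a', b') * conj (ψ (a, b') * ψ (a', b))).re =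
        purity (reducedA (ketbra ψ)) := by
    rw [purity, trace_reducedA_ketbra_mul_self]
    simp only [Complex.re_sum]
  simp only [eval_minorPoly, Complex.normSq_sub, Finset.sum_sub_distrib, Finset.sum_add_distrib,
    ← Finset.mul_sum, hcross, hnorm,
    (hswap fun a a' b b' => Complex.normSq (ψ (a, b) * ψ (a', b'))).trans hnorm]
  ring

theorem continuous_purity_reducedA :
    Continuous fun ρ : Matrix (A × B) (A × B) ℂ => purity (reducedA ρ) := by
  have hred : Continuous (reducedA : Matrix (A × B) (A × B) ℂ → Matrix A A ℂ) :=
    continuous_finsetSum _ fun b _ => continuous_id.matrix_submatrix _ _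
  exact Complex.continuous_re.comp (hred.matrix_mul hred).matrix_trace

variable [DecidableEq A] [DecidableEq B] [Nonempty A] [Nonempty B]

theorem integral_normSq_minorPoly_pair (a a' : A) (b b' : B) :
    ∫ x, Complex.normSq (eval x (minorPoly (a, b) (a', b') (a, b') (a', b))) ∂haarVector (A × B) =
      (if a = a' then 0 else 1) * (if b = b' then 0 else 1) *
        (2 / (Fintype.card (A × B) * (Fintype.card (A × B) + 1))) := by
  rcases eq_or_ne a a' with rfl | ha
  · simp [eval_minorPoly, mul_comm]
  rcases eq_or_ne b b' with rfl | hb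
  · simp [eval_minorPoly]
  rw [if_neg ha, if_neg hb, one_mul, one_mul]
  exact integral_normSq_minorPoly (by simp [ha, hb, ha.symm, hb.symm])

theorem sum_sum_ite_eq_zero_one (A : Type) [Fintype A] [DecidableEq A] :
    ∑ a : A, ∑ a' : A, (if a = a' then (0 : ℝ) else 1) =
      Fintype.card A * (Fintype.card A - 1) := by
  have hite (a a' : A) : (if a = a' then (0 : ℝ) else 1) = 1 - if a = a' then 1 else 0 := by
    split_ifs <;> simp
  simp only [hite, Finset.sum_sub_distrib, Finset.sum_const, Finset.card_univ, nsmul_eq_mul,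
    mul_one, Finset.sum_ite_eq, Finset.mem_univ, if_true]
  ring

theorem integral_purity_reducedA_haarState :
    ∫ ρ, purity (reducedA ρ) ∂haarState (A × B) =
      1 - (Fintype.card A - 1) * (Fintype.card B - 1) /
        (Fintype.card A * Fintype.card B + 1) := by
  have hint (a a' b b') : Integrable (fun x => Complex.normSq (eval x
      (minorPoly (a, b) (a', b') (a, b') (a', b)))) (haarVector (A × B)) :=
    integrable_haarVector (Complex.continuous_normSq.comp (continuous_eval _))
  have hsum : ∫ x, ∑ a, ∑ a', ∑ b, ∑ b', Complex.normSq (eval x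
      (minorPoly (a, b) (a', b') (a, b') (a', b))) ∂haarVector (A × B) =
        Fintype.card A * (Fintype.card A - 1) * (Fintype.card B * (Fintype.card B - 1)) *
          (2 / (Fintype.card (A × B) * (Fintype.card (A × B) + 1))) := by
    rw [integral_finsetSum _ fun a _ => integrable_finsetSum _ fun a' _ =>
      integrable_finsetSum _ fun b _ => integrable_finsetSum _ fun b' _ => hint a a' b b']
    simp only [integral_finsetSum _ fun a' _ => integrable_finsetSum _ fun b _ =>
        integrable_finsetSum _ fun b' _ => hint _ a' b b',
      integral_finsetSum _ fun b _ => integrable_finsetSum _ fun b' _ => hint _ _ b b',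
      integral_finsetSum _ fun b' _ => hint _ _ _ b', integral_normSq_minorPoly_pair,
      ← Finset.sum_mul, ← Finset.mul_sum, sum_sum_ite_eq_zero_one]
  rw [integral_haarState continuous_purity_reducedA,
    integral_congr_ae (ae_haarVector_mem_unitVectors.mono fun ψ hψ => purity_reducedA_ketbra hψ),
    integral_sub (integrable_const _) ((integrable_finsetSum _ fun a _ =>
      integrable_finsetSum _ fun a' _ => integrable_finsetSum _ fun b _ =>
        integrable_finsetSum _ fun b' _ => hint a a' b b').div_const 2), integral_div, hsum,
    Fintype.card_prod]
  have hA : (Fintype.card A : ℝ) ≠ 0 := by positivity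
  have hB : (Fintype.card B : ℝ) ≠ 0 := by positivity
  simp only [integral_const, probReal_univ, one_smul, Nat.cast_mul]
  field_simp

end MeanPurity

section SwapTestAcceptance

theorem pow_le_chord {x y : ℝ} (hx₀ : 0 ≤ x) (hx₁ : x < 1) (hxy : x ≤ y) (hy : y ≤ 1) (n : ℕ) :
    y ^ n ≤ 1 - (1 - y) / (1 - x) * (1 - x ^ n) := by
  have hx : 0 < 1 - x := sub_pos.mpr hx₁
  have hconvex := (convexOn_pow (𝕜 := ℝ) n).2 (show (1 : ℝ) ∈ Set.Ici 0 by simp)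
    (show x ∈ Set.Ici 0 from hx₀) (show 0 ≤ (y - x) / (1 - x) from div_nonneg (by linarith) hx.le)
    (show 0 ≤ (1 - y) / (1 - x) from div_nonneg (by linarith) hx.le) (by field_simp; ring)
  have hcombination : ((y - x) / (1 - x)) • (1 : ℝ) + ((1 - y) / (1 - x)) • x = y := by
    simp only [smul_eq_mul]
    field_simp
    ring
  rw [hcombination] at hconvex
  refine hconvex.trans_eq ?_
  simp only [smul_eq_mul, one_pow, mul_one]
  field_simp
  ring

section

variable {A B : Type} [Fintype A] [DecidableEq A] [Fintype B] [DecidableEq B]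
  [Nontrivial A] [Nonempty B]

theorem integral_one_add_purity_div_two_pow_le (n : ℕ) :
    ∫ ρ, ((1 + purity (reducedA ρ)) / 2) ^ n ∂haarState (A × B) ≤
      1 - Fintype.card A * (Fintype.card B - 1) / (Fintype.card A * Fintype.card B + 1) *
        (1 - ((1 + (Fintype.card A : ℝ)⁻¹) / 2) ^ n) := by
  have hcard : (1 : ℝ) < Fintype.card A := by exact_mod_cast Fintype.one_lt_card
  have hinv : (Fintype.card A : ℝ)⁻¹ < 1 := inv_lt_one_of_one_lt₀ hcard
  have hinv₀ : 0 ≤ (Fintype.card A : ℝ)⁻¹ := by positivity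
  have hintegrable {p : Matrix (A × B) (A × B) ℂ → ℝ} (hp : Continuous p) :=
    integrable_of_ae_mem_pureStates ae_haarState_mem_pureStates hp
  have hpurity := continuous_purity_reducedA (A := A) (B := B)
  set C := (1 - ((1 + (Fintype.card A : ℝ)⁻¹) / 2) ^ n) / (1 - (Fintype.card A : ℝ)⁻¹) with hC
  calc ∫ ρ, ((1 + purity (reducedA ρ)) / 2) ^ n ∂haarState (A × B)
    _ ≤ ∫ ρ, (1 - C * (1 - purity (reducedA ρ))) ∂haarState (A × B) := by
        refine integral_mono_ae (hintegrable (by fun_prop)) (hintegrable (by fun_prop)) ?_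
        filter_upwards [ae_haarState_mem_pureStates] with ρ hρ
        have hred := isDensity_reducedA (isDensity_of_mem_pureStates hρ)
        have hlower := inv_card_le_purity hred.1.1 hred.2
        have hupper := purity_le_one hred
        refine (pow_le_chord (x := (1 + (Fintype.card A : ℝ)⁻¹) / 2) (by linarith) (by linarith)
          (by linarith) (by linarith) n).trans_eq ?_
        have h₁ : 1 - (1 + purity (reducedA ρ)) / 2 = (1 - purity (reducedA ρ)) / 2 := by ring
        have h₂ : 1 - (1 + (Fintype.card A : ℝ)⁻¹) / 2 = (1 - (Fintype.card A : ℝ)⁻¹) / 2 := by ring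
        rw [hC, h₁, h₂, div_div_div_cancel_right₀ two_ne_zero]
        ring
    _ = 1 - C * ((Fintype.card A - 1) * (Fintype.card B - 1) /
          (Fintype.card A * Fintype.card B + 1)) := by
        rw [integral_sub (integrable_const _) (hintegrable (by fun_prop)), integral_const_mul,
          integral_sub (integrable_const _) (hintegrable hpurity),
          integral_purity_reducedA_haarState]
        simp only [integral_const, probReal_univ, one_smul, sub_sub_cancel]
    _ = _ := by
        have hcard₀ : (Fintype.card A : ℝ) - 1 ≠ 0 := by linarith
        rw [hC]
        field_simp

end

theorem integral_one_add_purity_div_two_pow_le_half_of_three_le {m : ℕ} [NeZero m] (hm : 3 ≤ m) :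
    ∫ ρ, ((1 + purity (reducedA ρ)) / 2) ^ 64 ∂haarState (Fin m × Fin m) ≤ 1 / 2 := by
  have : Nontrivial (Fin m) := Fin.nontrivial_iff_two_le.mpr (by omega)
  have hm' : (3 : ℝ) ≤ m := by exact_mod_cast hm
  have hinv : (m : ℝ)⁻¹ ≤ 3⁻¹ := inv_anti₀ (by norm_num) hm'
  have hpow : ((1 + (m : ℝ)⁻¹) / 2) ^ 64 ≤ 1 / 6 :=
    (pow_le_pow_left₀ (by positivity) (by linarith) 64).trans
      (show ((2 : ℝ) / 3) ^ 64 ≤ 1 / 6 by norm_num)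
  have hfactor : 3 / 5 ≤ (m : ℝ) * (m - 1) / (m * m + 1) := by
    rw [div_le_div_iff₀ (by norm_num) (by positivity)]
    nlinarith
  refine (integral_one_add_purity_div_two_pow_le 64).trans ?_
  rw [Fintype.card_fin]
  nlinarith

-- The slope `7` minimizes the mean of the right-hand side for `q = |det ψ| ^ 2`, where `ψ` is a
-- Haar vector in `ℂ² ⊗ ℂ²`.
theorem one_sub_pow_le_quadratic {q : ℝ} (h₀ : 0 ≤ q) (h₁ : q ≤ 1) :
    (1 - q) ^ 64 ≤ (1 - 7 * q) ^ 2 + 1 / 5 := by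
  rcases le_total q (1 / 32) with hq | hq
  · have hbernoulli : 1 + 64 * q ≤ (1 + q) ^ 64 := by
      exact_mod_cast one_add_mul_le_pow (a := q) (by linarith) 64
    have hprod : (1 - q) ^ 64 * (1 + q) ^ 64 ≤ 1 := by
      rw [← mul_pow]
      exact pow_le_one₀ (by nlinarith) (by nlinarith)
    have hle : (1 - q) ^ 64 * (1 + 64 * q) ≤ 1 :=
      (mul_le_mul_of_nonneg_left hbernoulli (pow_nonneg (by linarith) _)).trans hprod
    have hge : 1 ≤ ((1 - 7 * q) ^ 2 + 1 / 5) * (1 + 64 * q) := by nlinarith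
    exact le_of_mul_le_mul_right (hle.trans hge) (by positivity)
  · calc (1 - q) ^ 64 ≤ (31 / 32) ^ 64 := pow_le_pow_left₀ (by linarith) (by linarith) _
      _ ≤ 1 / 5 := by norm_num
      _ ≤ (1 - 7 * q) ^ 2 + 1 / 5 := by nlinarith [sq_nonneg (1 - 7 * q)]

theorem purity_reducedA_ketbra_fin_two {ψ : Fin 2 × Fin 2 → ℂ}
    (hψ : ψ ∈ unitVectors (Fin 2 × Fin 2)) :
    purity (reducedA (ketbra ψ)) =
      1 - 2 * Complex.normSq (eval ψ (minorPoly (0, 0) (1, 1) (0, 1) (1, 0))) := by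
  have hneg (z w : ℂ) : Complex.normSq (z - w) = Complex.normSq (w - z) := by
    rw [← Complex.normSq_neg, neg_sub]
  simp only [purity_reducedA_ketbra hψ, Fin.sum_univ_two, eval_minorPoly, sub_self, map_zero,
    mul_comm (ψ (0, 1)) (ψ (0, 0)), mul_comm (ψ (1, 0)) (ψ (0, 1)), mul_comm (ψ (1, 1)),
    hneg (ψ (0, 1) * ψ (1, 0))]
  ring

theorem integral_quadratic_normSq_minorPoly {ι : Type} [Fintype ι] [DecidableEq ι] [Nonempty ι]
    (hcard : Fintype.card ι = 4) {i j k l : ι} (h : [i, j, k, l].Nodup) :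
    ∫ x, ((1 - 7 * Complex.normSq (eval x (minorPoly i j k l))) ^ 2 + 1 / 5) ∂haarVector ι =
      1 / 2 := by
  have hfirst := integral_normSq_minorPoly h
  have hsecond := integral_normSq_minorPoly_sq h
  have hq : Continuous fun x => Complex.normSq (eval x (minorPoly i j k l)) :=
    Complex.continuous_normSq.comp (continuous_eval _)
  have hexpand (q : ℝ) : (1 - 7 * q) ^ 2 + 1 / 5 = 6 / 5 - 14 * q + 49 * q ^ 2 := by ring
  simp only [hexpand]
  rw [integral_add (integrable_haarVector (by fun_prop)) (integrable_haarVector (by fun_prop)),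
    integral_sub (integrable_const _) (integrable_haarVector (by fun_prop)), integral_const_mul,
    integral_const_mul, hsecond, hfirst, hcard]
  norm_num [integral_const]

theorem integral_one_add_purity_div_two_pow_le_half_fin_two :
    ∫ ρ, ((1 + purity (reducedA ρ)) / 2) ^ 64 ∂haarState (Fin 2 × Fin 2) ≤ 1 / 2 := by
  have hcont := continuous_purity_reducedA (A := Fin 2) (B := Fin 2)
  have hq := Complex.continuous_normSq.comp (continuous_eval
    (minorPoly ((0, 0) : Fin 2 × Fin 2) (1, 1) (0, 1) (1, 0)))
  rw [integral_haarState (by fun_prop), ← integral_quadratic_normSq_minorPoly (by simp)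
    (show [((0, 0) : Fin 2 × Fin 2), (1, 1), (0, 1), (1, 0)].Nodup by decide)]
  refine integral_mono_ae (integrable_haarVector ?_) (integrable_haarVector ?_) ?_
  · exact ((continuous_const.add (hcont.comp continuous_ketbra)).div_const 2).pow 64
  · exact ((continuous_const.sub (continuous_const.mul hq)).pow 2).add continuous_const
  filter_upwards [ae_haarVector_mem_unitVectors] with ψ hψ
  have hpurity := purity_reducedA_ketbra_fin_two hψ
  have hnonneg := Complex.normSq_nonneg (eval ψ (minorPoly (0, 0) (1, 1) (0, 1) (1, 0)))
  have hge : 0 ≤ purity (reducedA (ketbra ψ)) :=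
    (by positivity : (0 : ℝ) ≤ (Fintype.card (Fin 2) : ℝ)⁻¹).trans <|
      let hρ := isDensity_reducedA (isDensity_of_mem_pureStates ⟨ψ, hψ, rfl⟩)
      inv_card_le_purity hρ.1.1 hρ.2
  have haccept : (1 + purity (reducedA (ketbra ψ))) / 2 =
      1 - Complex.normSq (eval ψ (minorPoly (0, 0) (1, 1) (0, 1) (1, 0))) := by linarith
  simp only [haccept]
  exact one_sub_pow_le_quadratic hnonneg (by linarith)

theorem integral_one_add_purity_div_two_pow_le_half {m : ℕ} [NeZero m] (hm : 2 ≤ m) :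
    ∫ ρ, ((1 + purity (reducedA ρ)) / 2) ^ 64 ∂haarState (Fin m × Fin m) ≤ 1 / 2 := by
  rcases hm.eq_or_lt with rfl | hm
  · convert integral_one_add_purity_div_two_pow_le_half_fin_two
  · exact integral_one_add_purity_div_two_pow_le_half_of_three_le hm

end SwapTestAcceptance

section SwapTestGuarantees

theorem JointProtocol.continuous_detectProb {ι : Type} [Fintype ι] [DecidableEq ι] {T : ℕ}
    (P : JointProtocol ι T) : Continuous P.detectProb := by
  have htensor : Continuous fun ρ : Matrix ι ι ℂ => tensorPower ρ T :=
    continuous_matrix fun x y => show Continuous fun ρ : Matrix ι ι ℂ => ∏ t, ρ (x t) (y t) from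
      continuous_finsetProd _ fun t _ => continuous_id.matrix_elem (x t) (y t)
  refine continuous_finsetSum _ fun ω _ => ?_
  split_ifs
  · exact (P.povm.continuous_prob ω).comp htensor
  · exact continuous_const

theorem soundness_eq_div_completeness {A B : Type} [Fintype A] [Fintype B]
    (π : Measure (Matrix (A × B) (A × B) ℂ)) (p : Matrix (A × B) (A × B) ℂ → ℝ) :
    soundness π p = (∫ ρ in entangled A B, p ρ ∂π) / completeness π p :=
  rfl

variable {N : ℕ} [NeZero N]

theorem setIntegral_entangled_detectProb_swapTestProtocol {A B : Type} [Fintype A] [DecidableEq A]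
    [Fintype B] [DecidableEq B] {π : Measure (Matrix (A × B) (A × B) ℂ)}
    (hπ : ∀ᵐ ρ ∂π, ρ ∈ pureStates (A × B)) :
    ∫ ρ in entangled A B, (swapTestProtocol A B N).detectProb ρ ∂π =
      completeness π (swapTestProtocol A B N).detectProb := by
  refine setIntegral_eq_integral_of_ae_compl_eq_zero ?_
  filter_upwards [hπ] with ρ hρ hent
  have hdensity := isDensity_of_mem_pureStates hρ
  have hsep : IsSeparable ρ := by_contra fun hsep => hent ⟨hdensity, hsep⟩
  rw [detectProb_swapTestProtocol hdensity, hsep.purity_reducedA_eq_one hρ]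
  norm_num

theorem completeness_swapTestProtocol {m : ℕ} [NeZero m] :
    completeness (taskLaw m) (swapTestProtocol (Fin m) (Fin m) N).detectProb =
      (1 - ∫ ρ, ((1 + purity (reducedA ρ)) / 2) ^ N ∂haarState (Fin m × Fin m)) / 2 := by
  have hproduct : ∫ ρ, (swapTestProtocol (Fin m) (Fin m) N).detectProb ρ
      ∂haarProductState (Fin m) (Fin m) = 0 := by
    rw [← completeness, ← setIntegral_entangled_detectProb_swapTestProtocol
      ae_haarProductState_mem_pureStates]
    exact setIntegral_measure_zero _ (measure_eq_zero_iff_ae_notMem.mpr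
      ae_haarProductState_notMem_entangled)
  have hpurity := continuous_purity_reducedA (A := Fin m) (B := Fin m)
  rw [completeness_taskLaw (JointProtocol.continuous_detectProb _), hproduct, add_zero,
    integral_congr_ae (ae_haarState_mem_pureStates.mono fun ρ hρ =>
      detectProb_swapTestProtocol (isDensity_of_mem_pureStates hρ)),
    integral_sub (integrable_const _)
      (integrable_of_ae_mem_pureStates ae_haarState_mem_pureStates (by fun_prop))]
  simp only [integral_const, probReal_univ, one_smul]

theorem soundness_swapTestProtocol {m : ℕ} [NeZero m]
    (hcomplete : completeness (taskLaw m) (swapTestProtocol (Fin m) (Fin m) N).detectProb ≠ 0) :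
    soundness (taskLaw m) (swapTestProtocol (Fin m) (Fin m) N).detectProb = 1 := by
  rw [soundness_eq_div_completeness,
    setIntegral_entangled_detectProb_swapTestProtocol ae_taskLaw_mem_pureStates,
    div_self hcomplete]

theorem one_div_four_le_completeness_swapTestProtocol {m : ℕ} [NeZero m] (hm : 2 ≤ m) :
    1 / 4 ≤ completeness (taskLaw m) (swapTestProtocol (Fin m) (Fin m) 64).detectProb := by
  rw [completeness_swapTestProtocol]
  linarith [integral_one_add_purity_div_two_pow_le_half hm]

end SwapTestGuarantees

section Mixing

variable {ι : Type} [Fintype ι] [DecidableEq ι] {T : ℕ} {a b : ℝ}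

/-- The randomization of a protocol: with probability `a` follow `P`, with probability `b` declare
"entangled", and otherwise declare "not entangled". The random choice is part of the outcome. -/
noncomputable def JointProtocol.mix (P : JointProtocol ι T) (ha : 0 ≤ a) (hb : 0 ≤ b)
    (hab : a + b ≤ 1) : JointProtocol ι T where
  Outcome := P.Outcome ⊕ Bool
  povm :=
    { effect := Sum.elim (fun ω => (a : ℂ) • P.povm.effect ω)
        fun d => ((if d then b else 1 - a - b : ℝ) : ℂ) • 1
      posSemidef := by
        rintro (ω | d)
        · exact (P.povm.posSemidef ω).smul (by exact_mod_cast ha)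
        · refine PosSemidef.one.smul (Complex.zero_le_real.mpr ?_)
          split_ifs <;> linarith
      sum_effect := by
        simp only [Fintype.sum_sum_type, Sum.elim_inl, Sum.elim_inr, ← Finset.smul_sum,
          P.povm.sum_effect, Fintype.sum_bool, if_true, Bool.false_eq_true, if_false, ← add_smul]
        push_cast
        ring_nf
        exact one_smul ℂ 1 }
  estimator := Sum.elim P.estimator fun d => if d then -1 else 0

theorem JointProtocol.detectProb_mix (P : JointProtocol ι T) (ha : 0 ≤ a) (hb : 0 ≤ b)
    (hab : a + b ≤ 1) {ρ : Matrix ι ι ℂ} (hρ : ρ.trace = 1) :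
    (P.mix ha hb hab).detectProb ρ = a * P.detectProb ρ + b := by
  have htrace : (tensorPower ρ T).trace = 1 := by rw [trace_tensorPower, hρ, one_pow]
  change ∑ ω : P.Outcome ⊕ Bool, (if Sum.elim P.estimator (fun d => if d then -1 else 0) ω < 0
    then (P.mix ha hb hab).povm.prob (tensorPower ρ T) ω else 0) = _
  simp [Fintype.sum_sum_type, JointProtocol.mix, JointProtocol.detectProb, POVM.prob, htrace,
    Finset.mul_sum]

end Mixing

section ExactValues

variable {A B : Type} [Fintype A] [DecidableEq A] [Fintype B] [DecidableEq B] {T : ℕ} {a b : ℝ}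
  {π : Measure (Matrix (A × B) (A × B) ℂ)} [IsProbabilityMeasure π]

theorem JointProtocol.setIntegral_detectProb_mix (P : JointProtocol (A × B) T) (ha : 0 ≤ a)
    (hb : 0 ≤ b) (hab : a + b ≤ 1) (hπ : ∀ᵐ ρ ∂π, ρ ∈ pureStates (A × B))
    (s : Set (Matrix (A × B) (A × B) ℂ)) :
    ∫ ρ in s, (P.mix ha hb hab).detectProb ρ ∂π =
      a * ∫ ρ in s, P.detectProb ρ ∂π + b * π.real s := by
  have hint := integrable_of_ae_mem_pureStates hπ P.continuous_detectProb
  rw [integral_congr_ae (ae_restrict_of_ae (hπ.mono fun ρ hρ =>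
      P.detectProb_mix ha hb hab (isDensity_of_mem_pureStates hρ).2)),
    integral_add (hint.const_mul a).integrableOn (integrable_const b), integral_const_mul,
    setIntegral_const, smul_eq_mul, mul_comm b]

theorem JointProtocol.completeness_mix (P : JointProtocol (A × B) T) (ha : 0 ≤ a)
    (hb : 0 ≤ b) (hab : a + b ≤ 1) (hπ : ∀ᵐ ρ ∂π, ρ ∈ pureStates (A × B)) :
    completeness π (P.mix ha hb hab).detectProb = a * completeness π P.detectProb + b := by
  simpa only [completeness, setIntegral_univ, probReal_univ, mul_one] using
    P.setIntegral_detectProb_mix ha hb hab hπ Set.univ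

theorem exists_mix_weights {c q : ℝ} (hc : 1 / 4 ≤ c) (hq : q ≤ 1 / 2) :
    ∃ a b : ℝ, 0 ≤ a ∧ 0 ≤ b ∧ a + b ≤ 1 ∧ a * c + b = 1 / 4 ∧ a * c + b * q = 5 / 24 := by
  have hq' : 0 < 1 - q := by linarith
  obtain ⟨b, hb⟩ : ∃ b : ℝ, b * (1 - q) = 1 / 24 := ⟨1 / 24 / (1 - q), div_mul_cancel₀ _ hq'.ne'⟩
  have hb₀ : 0 ≤ b := by nlinarith
  have hb₁ : b ≤ 1 / 12 := by nlinarith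
  obtain ⟨a, ha⟩ : ∃ a : ℝ, a * c = 1 / 4 - b := ⟨(1 / 4 - b) / c, div_mul_cancel₀ _ (by linarith)⟩
  have ha₀ : 0 ≤ a := by nlinarith
  exact ⟨a, b, ha₀, hb₀, by nlinarith, by linarith, by linarith⟩

theorem JointProtocol.exists_completeness_eq_soundness_eq (P : JointProtocol (A × B) T)
    (hπ : ∀ᵐ ρ ∂π, ρ ∈ pureStates (A × B)) (hent : π.real (entangled A B) ≤ 1 / 2)
    (hcomplete : 1 / 4 ≤ completeness π P.detectProb) (hsound : soundness π P.detectProb = 1) :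
    ∃ Q : JointProtocol (A × B) T, completeness π Q.detectProb = 1 / 4 ∧
      soundness π Q.detectProb = 5 / 6 := by
  obtain ⟨a, b, ha, hb, hab, htotal, hentangled⟩ := exists_mix_weights hcomplete hent
  have hP : ∫ ρ in entangled A B, P.detectProb ρ ∂π = completeness π P.detectProb := by
    rwa [soundness_eq_div_completeness, div_eq_one_iff_eq (by linarith)] at hsound
  have hQ := (P.completeness_mix ha hb hab hπ).trans htotal
  refine ⟨P.mix ha hb hab, hQ, ?_⟩
  rw [soundness_eq_div_completeness, hQ, P.setIntegral_detectProb_mix ha hb hab hπ, hP, hentangled]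
  norm_num

end ExactValues

theorem rpow_one_div_four_natCast_sq (m : ℕ) : ((m ^ 2 : ℕ) : ℝ) ^ (1 / 4 : ℝ) = √m := by
  rw [Nat.cast_pow, ← Real.rpow_natCast, ← Real.rpow_mul (Nat.cast_nonneg m), Real.sqrt_eq_rpow]
  norm_num

end EDP

theorem mainTheorem5 :
    (∃ N : ℕ, ∀ (m : ℕ) [NeZero m], 2 ≤ m →
      (1 / 4 ≤ EDP.completeness (EDP.taskLaw m)
            (EDP.swapTestProtocol (Fin m) (Fin m) N).detectProb ∧
        5 / 6 ≤ EDP.soundness (EDP.taskLaw m)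
            (EDP.swapTestProtocol (Fin m) (Fin m) N).detectProb) ∧
      ∃ P : EDP.JointProtocol (Fin m × Fin m) (N * 2),
        EDP.completeness (EDP.taskLaw m) P.detectProb = 1 / 4 ∧
        EDP.soundness (EDP.taskLaw m) P.detectProb = 5 / 6) ∧
    (∃ c : ℝ, 0 < c ∧ ∀ (m : ℕ) [NeZero m], 2 ≤ m →
      ∀ (T : ℕ) (P : EDP.SingleCopyProtocol (Fin m × Fin m) T),
        1 / 4 ≤ EDP.completeness (EDP.taskLaw m) P.detectProb →
        5 / 6 ≤ EDP.soundness (EDP.taskLaw m) P.detectProb →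
        c * ((m ^ 2 : ℕ) : ℝ) ^ (1 / 4 : ℝ) ≤ (T : ℝ)) := by
  refine ⟨⟨64, fun m _ hm => ?_⟩, 1 / 2, by norm_num, fun m _ _ T P hcomplete hsound => ?_⟩
  · have hcomplete := EDP.one_div_four_le_completeness_swapTestProtocol hm
    have hsound := EDP.soundness_swapTestProtocol (by linarith)
    exact ⟨⟨hcomplete, by rw [hsound]; norm_num⟩,
      EDP.JointProtocol.exists_completeness_eq_soundness_eq _ EDP.ae_taskLaw_mem_pureStates
        EDP.taskLaw_real_entangled_le hcomplete hsound⟩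
  · have hm := EDP.le_three_mul_sq_of_completeness_of_soundness P hcomplete hsound
    have hsqrt : √(m : ℝ) ≤ 2 * T := Real.sqrt_le_iff.mpr ⟨by positivity, by nlinarith⟩
    rw [EDP.rpow_one_div_four_natCast_sq]
    linarith
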